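/- Let $M$ be the monoid defined by the presentation with generators $a, a^{-1}, b, b^{-1}, h$ (five symbols) and defining relations $$aa^{-1}=a^{-1}a=bb^{-1}=b^{-1}b=1,\qquad xh=hx,\quad hxy=hyx,\quad h^2x=h^2\quad (x,y\in\{a,a^{-1},b,b^{-1}\}),\qquad h^3=h^2 .$$ Elements $s,t$ of a monoid $S$ are $\mathcal H$-related if $sS=tS$ and $Ss=St$. The Schützenberger group of an $\mathcal H$-class $H$ is the quotient of $\mathrm{Stab}(H)=\{s\in S: Hs=H\}$ by the congruence $\{(s,t): xs=xt\}$, where $x\in H$ is fixed; up to isomorphism it does not depend on $x$. A monoid is presentable by a finite complete rewriting system if it has a presentation $\langle A\mid R\rangle$ with $A$ and $R$ finite such that the string rewriting system $R$ admits no infinite reduction sequence and is confluent. A monoid has finite derivation type (FDT) if it has a finite presentation $\langle A\mid R\rangle$ whose derivation graph (vertices: the words over $A$; edges $(w_1,r,\epsilon,w_2)$ from $w_1r_\epsilon w_2$ to $w_1r_{-\epsilon}w_2$, for $r=(r_{+1},r_{-1})\in R$, $\epsilon=\pm1$, $w_1,w_2\in A^*$) has a finite homotopy base. A homotopy base is a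 set $C$ of pairs of parallel paths such that every two parallel paths are related by the smallest equivalence relation on parallel paths that contains $C$, is compatible with composition of paths and with the two-sided action of $A^*$, relates $p\circ p^{-1}$ to the empty path for every path $p$, and relates $(e_1\cdot\iota e_2)\circ(\tau e_1\cdot e_2)$ to $(\iota e_1\cdot e_2)\circ(e_1\cdot\tau e_2)$ for all edges $e_1,e_2$, where $\iota e$ and $\tau e$ are the initial and terminal vertices of $e$. Theorem. (i) $M$ has exactly three $\mathcal H$-classes, and their Schützenberger groups are isomorphic to the trivial group, the free abelian group of rank two, and the free group of rank two, respectively. In particular, all Schützenberger groups of $M$ are presentable by finite complete rewriting systems and have finite derivation type. (ii) $M$ does not have finite derivation type, and it is not presentable by a finite complete rewriting system. -/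

import Mathlib

universe u v

/-! ### Rewriting systems and monoid presentations -/

/-- The monoid defined by the presentation `⟨A | R⟩`: the quotient of the free monoid on `A` by the
congruence generated by `R`. -/
abbrev MonoidOf {A : Type u} (R : Set (FreeMonoid A × FreeMonoid A)) : Type u :=
  PresentedMonoid fun x y => (x, y) ∈ R

/-- One-step reduction: `w₁ r₊ w₂ → w₁ r₋ w₂` for a rule `(r₊, r₋) ∈ R`. -/
def Rewrites {A : Type u} (R : Set (FreeMonoid A × FreeMonoid A)) (x y : FreeMonoid A) : Prop :=
  ∃ r ∈ R, ∃ w₁ w₂ : FreeMonoid A, x = w₁ * r.1 * w₂ ∧ y = w₁ * r.2 * w₂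

/-- There is no infinite reduction sequence. -/
def IsNoetherianRewriting {A : Type u} (R : Set (FreeMonoid A × FreeMonoid A)) : Prop :=
  ¬ ∃ f : ℕ → FreeMonoid A, ∀ n, Rewrites R (f n) (f (n + 1))

/-- Whenever `w` reduces to both `x` and `y`, these have a common descendant. -/
def IsConfluent {A : Type u} (R : Set (FreeMonoid A × FreeMonoid A)) : Prop :=
  ∀ w x y : FreeMonoid A, Relation.ReflTransGen (Rewrites R) w x →
    Relation.ReflTransGen (Rewrites R) w y →
    ∃ z, Relation.ReflTransGen (Rewrites R) x z ∧ Relation.ReflTransGen (Rewrites R) y z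

/-- A complete rewriting system: noetherian and confluent. -/
def IsCompleteRewriting {A : Type u} (R : Set (FreeMonoid A × FreeMonoid A)) : Prop :=
  IsNoetherianRewriting R ∧ IsConfluent R

/-- The monoid `S` has a presentation by a finite complete rewriting system. -/
def HasFiniteCompleteRewriting (S : Type v) [Monoid S] : Prop :=
  ∃ (A : Type) (R : Set (FreeMonoid A × FreeMonoid A)),
    Finite A ∧ R.Finite ∧ IsCompleteRewriting R ∧ Nonempty (MonoidOf R ≃* S)

/-! ### Derivation graphs and homotopy bases -/

/-- The vertex set of the derivation graph of `⟨A | R⟩`: all words over `A`. -/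
def DerivationGraph {A : Type u} (_R : Set (FreeMonoid A × FreeMonoid A)) : Type u := FreeMonoid A

namespace DerivationGraph

variable {A : Type u} {R : Set (FreeMonoid A × FreeMonoid A)}

instance : Monoid (DerivationGraph R) := inferInstanceAs (Monoid (FreeMonoid A))

/-- The side of the rule `r = (r₊, r₋)` of the given sign (`true` is `+1`, `false` is `-1`). -/
def side (r : R) (ε : Bool) : DerivationGraph R := if ε then r.1.1 else r.1.2

/-- An edge `(w₁, r, ε, w₂)` with initial vertex `x = w₁ r_ε w₂` and terminal vertex
`y = w₁ r_{-ε} w₂`. -/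
@[ext]
structure Edge (x y : DerivationGraph R) : Type u where
  left : DerivationGraph R
  rule : R
  sign : Bool
  right : DerivationGraph R
  initial_eq : x = left * side rule sign * right
  terminal_eq : y = left * side rule (!sign) * right

instance : Quiver (DerivationGraph R) := ⟨Edge⟩

/-- The inverse edge `(w₁, r, -ε, w₂)`. -/
def Edge.inv {x y : DerivationGraph R} (e : Edge x y) : Edge y x where
  left := e.left
  rule := e.rule
  sign := !e.sign
  right := e.right
  initial_eq := e.terminal_eq
  terminal_eq := by rw [Bool.not_not]; exact e.initial_eq

instance : Quiver.HasInvolutiveReverse (DerivationGraph R) where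
  reverse' e := e.inv
  inv' e := Edge.ext rfl rfl (Bool.not_not e.sign) rfl

/-- The left action of the word `w` on edges: `w · (w₁, r, ε, w₂) = (w w₁, r, ε, w₂)`. -/
def edgeLeft (w : DerivationGraph R) {x y : DerivationGraph R} (e : x ⟶ y) : w * x ⟶ w * y :=
  Edge.mk (w * Edge.left e) (Edge.rule e) (Edge.sign e) (Edge.right e)
    ((congrArg (w * ·) (Edge.initial_eq e)).trans (by simp only [mul_assoc]))
    ((congrArg (w * ·) (Edge.terminal_eq e)).trans (by simp only [mul_assoc]))

/-- The right action of the word `w` on edges: `(w₁, r, ε, w₂) · w = (w₁, r, ε, w₂ w)`. -/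
def edgeRight {x y : DerivationGraph R} (e : x ⟶ y) (w : DerivationGraph R) : x * w ⟶ y * w :=
  Edge.mk (Edge.left e) (Edge.rule e) (Edge.sign e) (Edge.right e * w)
    ((congrArg (· * w) (Edge.initial_eq e)).trans (by simp only [mul_assoc]))
    ((congrArg (· * w) (Edge.terminal_eq e)).trans (by simp only [mul_assoc]))

/-- The two-sided action `e ↦ w · e · z` of the free monoid on the graph; it acts on paths through
`Prefunctor.mapPath`. -/
def act (w z : DerivationGraph R) : DerivationGraph R ⥤q DerivationGraph R where
  obj x := w * x * z
  map e := edgeRight (edgeLeft w e) z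

/-- A homotopy relation on the paths of the derivation graph. Two paths are parallel precisely when
they lie in the same type `Quiver.Path x y`, so a relation contained in parallelism is a family of
relations, one on each of these types. -/
structure IsHomotopyRelation
    (r : ∀ ⦃x y : DerivationGraph R⦄, Quiver.Path x y → Quiver.Path x y → Prop) : Prop where
  equivalence : ∀ x y : DerivationGraph R, Equivalence (@r x y)
  /-- `(e₁ · ιe₂) ∘ (τe₁ · e₂) ∼ (ιe₁ · e₂) ∘ (e₁ · τe₂)` -/
  interchange : ∀ {x₁ y₁ x₂ y₂ : DerivationGraph R} (e₁ : x₁ ⟶ y₁) (e₂ : x₂ ⟶ y₂),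
    r ((edgeRight e₁ x₂).toPath.comp (edgeLeft y₁ e₂).toPath)
      ((edgeLeft x₁ e₂).toPath.comp (edgeRight e₁ y₂).toPath)
  /-- compatibility with the two-sided action of the free monoid -/
  act : ∀ {x y : DerivationGraph R} (p q : Quiver.Path x y) (w z : DerivationGraph R),
    r p q → r ((DerivationGraph.act w z).mapPath p) ((DerivationGraph.act w z).mapPath q)
  /-- compatibility with composition -/
  comp : ∀ {x' x y y' : DerivationGraph R} (s : Quiver.Path x' x) (p q : Quiver.Path x y)
    (t : Quiver.Path y y'), r p q → r ((s.comp p).comp t) ((s.comp q).comp t)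
  /-- `p ∘ p⁻¹ ∼ 1` -/
  inv : ∀ {x y : DerivationGraph R} (p : Quiver.Path x y), r (p.comp p.reverse) Quiver.Path.nil

/-- The type of pairs of parallel paths of the derivation graph. -/
abbrev ParallelPair (R : Set (FreeMonoid A × FreeMonoid A)) : Type u :=
  Σ x y : DerivationGraph R, Quiver.Path x y × Quiver.Path x y

/-- The homotopy relation generated by `C`, the smallest one that contains `C`. -/
def Homotopic (C : Set (ParallelPair R)) {x y : DerivationGraph R} (p q : Quiver.Path x y) : Prop :=
  ∀ r : ∀ ⦃x y : DerivationGraph R⦄, Quiver.Path x y → Quiver.Path x y → Prop,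
    IsHomotopyRelation r → (∀ c ∈ C, r c.2.2.1 c.2.2.2) → r p q

/-- `C` is a homotopy base: the homotopy relation that it generates is parallelism. -/
def IsHomotopyBase (C : Set (ParallelPair R)) : Prop :=
  ∀ ⦃x y : DerivationGraph R⦄ (p q : Quiver.Path x y), Homotopic C p q

end DerivationGraph

/-- The presentation `⟨A | R⟩` has finite derivation type. -/
def PresentationFDT {A : Type u} (R : Set (FreeMonoid A × FreeMonoid A)) : Prop :=
  ∃ C : Set (DerivationGraph.ParallelPair R), C.Finite ∧ DerivationGraph.IsHomotopyBase C

/-- The monoid `S` has finite derivation type: it has a finite presentation which has finite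
derivation type. -/
def HasFDT (S : Type v) [Monoid S] : Prop :=
  ∃ (A : Type) (R : Set (FreeMonoid A × FreeMonoid A)),
    Finite A ∧ R.Finite ∧ Nonempty (MonoidOf R ≃* S) ∧ PresentationFDT R

/-! ### Green's relations and Schützenberger groups -/

section Green

variable {S : Type v} [Monoid S]

/-- Green's relation `R`: `xS = yS`. -/
def GreenR (x y : S) : Prop := Set.range (fun s => x * s) = Set.range (fun s => y * s)

/-- Green's relation `L`: `Sx = Sy`. -/
def GreenL (x y : S) : Prop := Set.range (fun s => s * x) = Set.range (fun s => s * y)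

/-- Green's relation `H`, the intersection of `R` and `L`. -/
def GreenH (x y : S) : Prop := GreenR x y ∧ GreenL x y

/-- The `H`-class of `x`. -/
def hClass (x : S) : Set S := {y | GreenH y x}

/-- `H` is an `H`-class of `S`. -/
def IsHClass (H : Set S) : Prop := ∃ x : S, H = hClass x

theorem greenR_iff {x y : S} : GreenR x y ↔ (∃ s, x * s = y) ∧ ∃ s, y * s = x := by
  constructor
  · intro h
    unfold GreenR at h
    constructor
    · have : y ∈ Set.range (fun s => y * s) := ⟨1, mul_one y⟩
      rw [← h] at this; exact this
    · have : x ∈ Set.range (fun s => x * s) := ⟨1, mul_one x⟩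
      rw [h] at this; exact this
  · rintro ⟨⟨s, rfl⟩, t, ht⟩
    apply Set.Subset.antisymm
    · rintro _ ⟨w, rfl⟩
      exact ⟨t * w, by simp only [← mul_assoc, ht]⟩
    · rintro _ ⟨w, rfl⟩
      exact ⟨s * w, by simp only [← mul_assoc]⟩

theorem greenL_iff {x y : S} : GreenL x y ↔ (∃ s, s * x = y) ∧ ∃ s, s * y = x := by
  constructor
  · intro h
    unfold GreenL at h
    constructor
    · have : y ∈ Set.range (fun s => s * y) := ⟨1, one_mul y⟩
      rw [← h] at this; exact this
    · have : x ∈ Set.range (fun s => s * x) := ⟨1, one_mul x⟩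
      rw [h] at this; exact this
  · rintro ⟨⟨s, rfl⟩, t, ht⟩
    apply Set.Subset.antisymm
    · rintro _ ⟨w, rfl⟩
      exact ⟨w * t, by simp only [mul_assoc, ht]⟩
    · rintro _ ⟨w, rfl⟩
      exact ⟨w * s, by simp only [mul_assoc]⟩

theorem mem_hClass_self (x : S) : x ∈ hClass x := ⟨rfl, rfl⟩

/-- The right setwise stabiliser `Stab(H) = {s | Hs = H}` of the `H`-class `H` of `x`. -/
def hStab (x : S) : Submonoid S where
  carrier := {s | (fun y => y * s) '' hClass x = hClass x}
  one_mem' := by simp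
  mul_mem' := by
    intro s t hs ht
    have hs' : (fun y => y * s) '' hClass x = hClass x := hs
    have ht' : (fun y => y * t) '' hClass x = hClass x := ht
    change (fun y => y * (s * t)) '' hClass x = hClass x
    calc (fun y => y * (s * t)) '' hClass x
        = (fun y => y * t) '' ((fun y => y * s) '' hClass x) := by
          rw [Set.image_image]; simp only [mul_assoc]
      _ = hClass x := by rw [hs', ht']

theorem mul_mem_hClass {x y s : S} (hs : s ∈ hStab x) (hy : y ∈ hClass x) : y * s ∈ hClass x := by
  have h : (fun y => y * s) '' hClass x = hClass x := hs
  rw [← h]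
  exact ⟨y, hy, rfl⟩

/-- The Schützenberger congruence `{(s, t) | xs = xt}` on the stabiliser of the `H`-class of `x`. -/
def schutzenbergerCon (x : S) : Con (hStab x) where
  r s t := x * (s : S) = x * (t : S)
  iseqv := ⟨fun _ => rfl, fun h => h.symm, fun h h' => h.trans h'⟩
  mul' := by
    intro s t s' t' h h'
    obtain ⟨-, w, hw⟩ := greenL_iff.1 (mul_mem_hClass t.2 (mem_hClass_self x)).2
    simp only [Submonoid.coe_mul, ← mul_assoc, h]
    rw [← hw, mul_assoc, mul_assoc, h']

/-- The Schützenberger group of the `H`-class of `x`. -/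
abbrev SchutzenbergerGroup (x : S) : Type v := (schutzenbergerCon x).Quotient

theorem exists_hStab_inv (x : S) (s : hStab x) :
    ∃ t : hStab x, x * (t : S) * (s : S) = x := by
  have hs : (fun y => y * (s : S)) '' hClass x = hClass x := s.2
  obtain ⟨t, ht⟩ := (greenR_iff.1 (mul_mem_hClass s.2 (mem_hClass_self x)).1).1
  have hst : ∀ z ∈ hClass x, z * (s : S) * t = z := by
    intro z hz
    obtain ⟨w, hw⟩ := (greenL_iff.1 hz.2).2
    rw [← hw, mul_assoc w, mul_assoc w, ht]
  have himg : (fun y => y * t) '' hClass x = hClass x := by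
    conv_lhs => rw [← hs]
    rw [Set.image_image]
    ext z
    constructor
    · rintro ⟨y, hy, rfl⟩
      simpa only [hst y hy] using hy
    · intro hz
      exact ⟨z, hz, hst z hz⟩
  refine ⟨⟨t, himg⟩, ?_⟩
  have hx : x ∈ (fun y => y * (s : S)) '' hClass x := by rw [hs]; exact mem_hClass_self x
  obtain ⟨y, hy, hyx⟩ := hx
  have hyx' : y * (s : S) = x := hyx
  change x * t * (s : S) = x
  calc x * t * (s : S) = y * (s : S) * t * (s : S) := by rw [hyx']
    _ = y * (s : S) := by rw [hst y hy]
    _ = x := hyx'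

theorem exists_left_inv (x : S) (g : SchutzenbergerGroup x) :
    ∃ g' : SchutzenbergerGroup x, g' * g = 1 := by
  induction g using Con.induction_on with
  | H s =>
    obtain ⟨t, ht⟩ := exists_hStab_inv x s
    refine ⟨(t : SchutzenbergerGroup x), ?_⟩
    rw [← Con.coe_mul, ← Con.coe_one, Con.eq]
    change x * ((t : S) * (s : S)) = x * 1
    rw [mul_one, ← mul_assoc, ht]

noncomputable instance (x : S) : Group (SchutzenbergerGroup x) :=
  { (inferInstance : Monoid (SchutzenbergerGroup x)) with
    inv := fun g => Classical.choose (exists_left_inv x g)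
    inv_mul_cancel := fun g => Classical.choose_spec (exists_left_inv x g) }

end Green

/-! ### The monoid `M` -/

/-- The generators `a, a⁻¹, b, b⁻¹, h`. -/
inductive Gen : Type
  | a | a' | b | b' | h

namespace Gen

/-- The generators `a, a⁻¹, b, b⁻¹` as words. -/
def units : Set (FreeMonoid Gen) :=
  {FreeMonoid.of a, FreeMonoid.of a', FreeMonoid.of b, FreeMonoid.of b'}

/-- The generator `h` as a word. -/
def H : FreeMonoid Gen := FreeMonoid.of h

/-- The defining relations of `M`. -/
def relations : Set (FreeMonoid Gen × FreeMonoid Gen) :=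
  {(FreeMonoid.of a * FreeMonoid.of a', 1), (FreeMonoid.of a' * FreeMonoid.of a, 1),
    (FreeMonoid.of b * FreeMonoid.of b', 1), (FreeMonoid.of b' * FreeMonoid.of b, 1)} ∪
  {p | ∃ x ∈ units, p = (x * H, H * x)} ∪
  {p | ∃ x ∈ units, ∃ y ∈ units, p = (H * x * y, H * y * x)} ∪
  {p | ∃ x ∈ units, p = (H ^ 2 * x, H ^ 2)} ∪
  {(H ^ 3, H ^ 2)}

end Gen

/-- The monoid `M`. -/
abbrev MonoidM : Type := MonoidOf Gen.relations

/-! ### Derivation graphs: paths and homotopies -/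

namespace DerivationGraph

variable {A : Type u} {R : Set (FreeMonoid A × FreeMonoid A)}

/-! Write F for the free group on a, b and Q for its abelianization. The relations collapse M to the
disjoint union of F, of Q (the elements hg, which depend only on the image of g in Q), and of a zero
h². These three layers are the H-classes (`MonoidM.modelEquiv`, `MonoidM.setOf_isHClass`). Units act
transitively on each layer, so a Schützenberger group is F modulo the stabiliser of a point: F, Q or
1. Each has an explicit finite complete system, and Squier's theorem
(`presentationFDT_of_isCompleteRewriting`) turns this into FDT. By the same theorem, the failure of
FDT for M rules out finite complete systems for M.

For that failure, take any presentation of M. Lift words to `PairMonoid`, where the middle layer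
remembers a pair (x, y), thought of as x h y⁻¹, instead of its image in Q. A derivation from (x, y)
to (x', y') has the displacement (x⁻¹x', y⁻¹y'), which lies in the fibre product F ×_Q F.
Multiplying by units on either side changes x and y on the left only, so the displacement of an edge
is determined by its signed rule.

Each such displacement (c, d) is now lifted to a matrix in `AffineHeisenberg`: the upper block
represents c, the lower block represents d, and the diagonal entry t agrees because it factors
through Q. Only the central corner entry z is free. Choosing one lift per rule labels all paths, and
parallel paths then have labels that differ only in z. Interchange costs nothing: of two factors
with nonzero product one is a unit, whose edges have label 1. A finite homotopy base therefore
confines all these differences to a finitely generated subgroup of ℚ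
(`IsLiftLabelling.exists_finite_congrMod`).

On the other hand, moving x by [aⁿ, b] and y by [a, b] can be done in either order. The two
resulting parallel paths have labels mk and km, whose corners differ by (1/2)ⁿ - 1
(`IsLift.mul_z_sub_mul_z`). No finitely generated subgroup of ℚ contains all these numbers. -/

theorem homotopic_isHomotopyRelation (C : Set (ParallelPair R)) :
    IsHomotopyRelation (fun _ _ p q => Homotopic C p q) where
  equivalence x y :=
    ⟨fun p _ hr _ => (hr.equivalence x y).refl p,
      fun h r hr hC => (hr.equivalence x y).symm (h r hr hC),
      fun h h' r hr hC => (hr.equivalence x y).trans (h r hr hC) (h' r hr hC)⟩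
  interchange e₁ e₂ _ hr _ := hr.interchange e₁ e₂
  act p q w z h r hr hC := hr.act p q w z (h r hr hC)
  comp s p q t h r hr hC := hr.comp s p q t (h r hr hC)
  inv p _ hr _ := hr.inv p

namespace Homotopic

variable {C : Set (ParallelPair R)} {x y z : DerivationGraph R}

theorem refl (p : Quiver.Path x y) : Homotopic C p p :=
  ((homotopic_isHomotopyRelation C).equivalence x y).refl p

theorem symm {p q : Quiver.Path x y} (h : Homotopic C p q) : Homotopic C q p :=
  ((homotopic_isHomotopyRelation C).equivalence x y).symm h

theorem trans {p q r : Quiver.Path x y} (h : Homotopic C p q) (h' : Homotopic C q r) :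
    Homotopic C p r :=
  ((homotopic_isHomotopyRelation C).equivalence x y).trans h h'

theorem comp_left (s : Quiver.Path x y) {p q : Quiver.Path y z} (h : Homotopic C p q) :
    Homotopic C (s.comp p) (s.comp q) :=
  (homotopic_isHomotopyRelation C).comp s p q .nil h

theorem comp_right {p q : Quiver.Path x y} (h : Homotopic C p q) (t : Quiver.Path y z) :
    Homotopic C (p.comp t) (q.comp t) := by
  simpa using (homotopic_isHomotopyRelation C).comp .nil p q t h

theorem comp_reverse (p : Quiver.Path x y) : Homotopic C (p.comp p.reverse) .nil :=
  (homotopic_isHomotopyRelation C).inv p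

theorem mapPath (w z : DerivationGraph R) {p q : Quiver.Path x y} (h : Homotopic C p q) :
    Homotopic C ((DerivationGraph.act w z).mapPath p) ((DerivationGraph.act w z).mapPath q) :=
  (homotopic_isHomotopyRelation C).act p q w z h

theorem of_mem {c : ParallelPair R} (hc : c ∈ C) : Homotopic C c.2.2.1 c.2.2.2 :=
  fun _ _ hC => hC c hc

end Homotopic

/-- The paths all of whose edges have sign `+1`. -/
inductive IsPositive : ∀ {x y : DerivationGraph R}, Quiver.Path x y → Prop
  | nil (x : DerivationGraph R) : IsPositive (Quiver.Path.nil : Quiver.Path x x)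
  | head {x y z : DerivationGraph R} (e : x ⟶ y) (he : Edge.sign e = true) (p : Quiver.Path y z) :
      IsPositive p → IsPositive (e.toPath.comp p)

theorem IsPositive.comp {x y z : DerivationGraph R} {p : Quiver.Path x y} {q : Quiver.Path y z}
    (hp : IsPositive p) (hq : IsPositive q) : IsPositive (p.comp q) := by
  induction hp with
  | nil => simpa using hq
  | head e he p _ ih =>
    rw [Quiver.Path.comp_assoc]
    exact .head e he _ (ih hq)

theorem IsPositive.mapPath {x y : DerivationGraph R} {p : Quiver.Path x y} (hp : IsPositive p)
    (w z : DerivationGraph R) : IsPositive ((DerivationGraph.act w z).mapPath p) := by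
  induction hp with
  | nil => exact .nil _
  | head e he p _ ih =>
    rw [Prefunctor.mapPath_comp]
    exact .head ((DerivationGraph.act w z).map e) he _ ih

theorem rewrites_of_edge {x y : DerivationGraph R} (e : x ⟶ y) (he : Edge.sign e = true) :
    Rewrites R x y := by
  obtain ⟨l, r, s, q, h₁, h₂⟩ := e
  change s = true at he
  subst he
  exact ⟨r.1, r.2, l, q, h₁, h₂⟩

theorem exists_edge_of_rewrites {x y : DerivationGraph R} (h : Rewrites R x y) :
    ∃ e : x ⟶ y, Edge.sign e = true := by
  obtain ⟨r, hr, w₁, w₂, h₁, h₂⟩ := h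
  exact ⟨Edge.mk w₁ ⟨r, hr⟩ true w₂ h₁ h₂, rfl⟩

theorem IsPositive.reflTransGen {x y : DerivationGraph R} {p : Quiver.Path x y}
    (hp : IsPositive p) : Relation.ReflTransGen (Rewrites R) x y := by
  induction hp with
  | nil => exact .refl
  | head e he p _ ih => exact .head (rewrites_of_edge e he) ih

theorem exists_isPositive {x y : DerivationGraph R}
    (h : Relation.ReflTransGen (Rewrites R) x y) : ∃ p : Quiver.Path x y, IsPositive p := by
  induction h using Relation.ReflTransGen.head_induction_on with
  | refl => exact ⟨.nil, .nil _⟩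
  | head h _ ih =>
    obtain ⟨e, he⟩ := exists_edge_of_rewrites h
    obtain ⟨p, hp⟩ := ih
    exact ⟨_, .head e he p hp⟩

/-- A peak of positive edges that closes up, modulo homotopy, along positive paths. -/
def Closes (C : Set (ParallelPair R)) {w x y : DerivationGraph R} (e : w ⟶ x) (f : w ⟶ y) : Prop :=
  ∃ (z : DerivationGraph R) (p : Quiver.Path x z) (q : Quiver.Path y z),
    IsPositive p ∧ IsPositive q ∧ Homotopic C (e.toPath.comp p) (f.toPath.comp q)

theorem Closes.symm {C : Set (ParallelPair R)} {w x y : DerivationGraph R} {e : w ⟶ x}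
    {f : w ⟶ y} (h : Closes C e f) : Closes C f e := by
  obtain ⟨z, p, q, hp, hq, h⟩ := h
  exact ⟨z, q, p, hq, hp, h.symm⟩

theorem Closes.act {C : Set (ParallelPair R)} {w x y : DerivationGraph R} {e : w ⟶ x}
    {f : w ⟶ y} (h : Closes C e f) (u v : DerivationGraph R) :
    Closes C ((DerivationGraph.act u v).map e) ((DerivationGraph.act u v).map f) := by
  obtain ⟨z, p, q, hp, hq, h⟩ := h
  exact ⟨_, _, _, hp.mapPath u v, hq.mapPath u v, by
    simpa only [Prefunctor.mapPath_comp, Prefunctor.mapPath_toPath] using h.mapPath u v⟩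

/-- The interchange square itself closes the peak, so disjoint rule applications need no element of
`C`. -/
theorem closes_disjoint (C : Set (ParallelPair R)) {x₁ y₁ x₂ y₂ : DerivationGraph R}
    (e : x₁ ⟶ y₁) (f : x₂ ⟶ y₂) (he : Edge.sign e = true) (hf : Edge.sign f = true) :
    Closes C (edgeRight e x₂) (edgeLeft x₁ f) := by
  refine ⟨y₁ * y₂, (edgeLeft y₁ f).toPath, (edgeRight e y₂).toPath, ?_, ?_,
    (homotopic_isHomotopyRelation C).interchange e f⟩
  · simpa using IsPositive.head (edgeLeft y₁ f) hf .nil (.nil _)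
  · simpa using IsPositive.head (edgeRight e y₂) he .nil (.nil _)

/-- Closing of a peak passes to its two-sided translates. -/
theorem Closes.of_translate {C : Set (ParallelPair R)} {w x y w₀ x₀ y₀ : DerivationGraph R}
    {e : w ⟶ x} {f : w ⟶ y} {e₀ : w₀ ⟶ x₀} {f₀ : w₀ ⟶ y₀} (h : Closes C e₀ f₀)
    (u v : DerivationGraph R)
    (hel : Edge.left e = u * Edge.left e₀) (her : Edge.right e = Edge.right e₀ * v)
    (hes : Edge.sign e = Edge.sign e₀) (heq : Edge.rule e = Edge.rule e₀)
    (hfl : Edge.left f = u * Edge.left f₀) (hfr : Edge.right f = Edge.right f₀ * v)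
    (hfs : Edge.sign f = Edge.sign f₀) (hfq : Edge.rule f = Edge.rule f₀) : Closes C e f := by
  obtain rfl : w = u * w₀ * v := by
    rw [Edge.initial_eq e, Edge.initial_eq e₀, hel, her, hes, heq]
    simp only [mul_assoc]
  obtain rfl : x = u * x₀ * v := by
    rw [Edge.terminal_eq e, Edge.terminal_eq e₀, hel, her, hes, heq]
    simp only [mul_assoc]
  obtain rfl : y = u * y₀ * v := by
    rw [Edge.terminal_eq f, Edge.terminal_eq f₀, hfl, hfr, hfs, hfq]
    simp only [mul_assoc]
  rw [show e = (DerivationGraph.act u v).map e₀ from Edge.ext hel heq hes her,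
    show f = (DerivationGraph.act u v).map f₀ from Edge.ext hfl hfq hfs hfr]
  exact h.act u v

/-! ### Irreducible words and normal forms -/

theorem eq_of_irreducible {x y : DerivationGraph R} (hx : ∀ y, ¬ Rewrites R x y)
    (h : Relation.ReflTransGen (Rewrites R) x y) : x = y := by
  rcases h.cases_head with h | ⟨z, h, -⟩
  · exact h
  · exact (hx z h).elim

theorem wellFounded_of_noetherian (h : IsNoetherianRewriting R) :
    WellFounded fun x y : DerivationGraph R => Rewrites R y x := by
  rw [wellFounded_iff_isEmpty_descending_chain]
  exact ⟨fun f => h ⟨f.1, f.2⟩⟩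

theorem exists_irreducible (h : IsNoetherianRewriting R) (x : DerivationGraph R) :
    ∃ z : DerivationGraph R, Relation.ReflTransGen (Rewrites R) x z ∧ ∀ y, ¬ Rewrites R z y := by
  induction x using (wellFounded_of_noetherian h).induction with
  | _ x ih =>
    by_cases hx : ∃ y, Rewrites R x y
    · obtain ⟨y, hy⟩ := hx
      obtain ⟨z, hz, hz'⟩ := ih y hy
      exact ⟨z, .head hy hz, hz'⟩
    · exact ⟨x, .refl, not_exists.1 hx⟩

theorem irreducible_unique (h : IsConfluent R) {x z z' : DerivationGraph R}
    (hz : Relation.ReflTransGen (Rewrites R) x z) (hz' : Relation.ReflTransGen (Rewrites R) x z')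
    (hi : ∀ y, ¬ Rewrites R z y) (hi' : ∀ y, ¬ Rewrites R z' y) : z = z' := by
  obtain ⟨t, ht, ht'⟩ := h x z z' hz hz'
  rw [eq_of_irreducible hi ht, eq_of_irreducible hi' ht']

/-! ### Squier's theorem: a homotopy base from the closing of peaks -/

section Squier

variable {C : Set (ParallelPair R)}

/-- If every peak closes up, then any two positive paths to an irreducible word are homotopic. -/
theorem homotopic_of_isPositive (hR : IsCompleteRewriting R)
    (hC : ∀ {w x y : DerivationGraph R} (e : w ⟶ x) (f : w ⟶ y), Edge.sign e = true →
      Edge.sign f = true → Closes C e f) {z : DerivationGraph R} (hz : ∀ y, ¬ Rewrites R z y)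
    (x : DerivationGraph R) : ∀ p q : Quiver.Path x z, IsPositive p → IsPositive q →
      Homotopic C p q := by
  induction x using (wellFounded_of_noetherian hR.1).induction with
  | _ x ih =>
    intro p q hp hq
    cases hp with
    | nil =>
      cases hq with
      | nil => exact .refl _
      | head f hf q hq => exact (hz _ (rewrites_of_edge f hf)).elim
    | head e he p hp =>
      cases hq with
      | nil => exact (hz _ (rewrites_of_edge e he)).elim
      | head f hf q hq =>
        -- The peak closes at `t`, and `t` descends further to the same irreducible `z`; induction
        -- applies at both ends of the peak.
        obtain ⟨t, p', q', hp', hq', h⟩ := hC e f he hf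
        obtain ⟨z', hz', hi'⟩ := exists_irreducible hR.1 t
        obtain rfl : z = z' := irreducible_unique hR.2 hp.reflTransGen
          (hp'.reflTransGen.trans hz') hz hi'
        obtain ⟨n, hn⟩ := exists_isPositive (R := R) hz'
        have h₁ := ih _ (rewrites_of_edge e he) p (p'.comp n) hp (hp'.comp hn)
        have h₂ := ih _ (rewrites_of_edge f hf) q (q'.comp n) hq (hq'.comp hn)
        refine (h₁.comp_left _).trans (.trans ?_ (h₂.comp_left _).symm)
        rw [← Quiver.Path.comp_assoc, ← Quiver.Path.comp_assoc]
        exact h.comp_right n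

/-- Each edge of `p` can be absorbed into the descent to the normal form. A positive edge just
lengthens the descent. A negative edge `e` is cancelled: the given descent is homotopic to `e⁻¹`
followed by another descent. -/
theorem homotopic_comp_isPositive (hR : IsCompleteRewriting R)
    (hC : ∀ {w x y : DerivationGraph R} (e : w ⟶ x) (f : w ⟶ y), Edge.sign e = true →
      Edge.sign f = true → Closes C e f) {z : DerivationGraph R} (hz : ∀ y, ¬ Rewrites R z y)
    {x y : DerivationGraph R} (p : Quiver.Path x y) (m : Quiver.Path x z) (hm : IsPositive m) :
    ∀ n : Quiver.Path y z, IsPositive n → Homotopic C (p.comp n) m := by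
  induction p with
  | nil =>
    intro n hn
    simpa using homotopic_of_isPositive hR hC hz _ n m hn hm
  | @cons y' y p e ih =>
    intro n hn
    rw [← Quiver.Path.comp_toPath_eq_cons, Quiver.Path.comp_assoc]
    cases he : Edge.sign e with
    | true => exact ih _ (.head e he n hn)
    | false =>
      have he' : Edge.sign (Quiver.reverse e) = true := congrArg (!·) he
      obtain ⟨z', hz', hi'⟩ := exists_irreducible hR.1 y'
      obtain ⟨n', hn'⟩ := exists_isPositive (R := R) hz'
      have hpos := IsPositive.head (Quiver.reverse e) he' n' hn'
      obtain rfl : z = z' := irreducible_unique hR.2 hn.reflTransGen hpos.reflTransGen hz hi'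
      have h := homotopic_of_isPositive hR hC hz _ _ _ hpos hn
      refine .trans ?_ (ih n' hn')
      refine Homotopic.comp_left p (.trans (h.symm.comp_left _) ?_)
      rw [← Quiver.Path.comp_assoc, ← Quiver.Path.reverse_toPath]
      simpa using (Homotopic.comp_reverse e.toPath).comp_right n'

/-- Followed by a descent `n` from their common end, parallel paths both become homotopic to one
descent from their common start; then `n` cancels. -/
theorem isHomotopyBase_of_closes (hR : IsCompleteRewriting R)
    (hC : ∀ {w x y : DerivationGraph R} (e : w ⟶ x) (f : w ⟶ y), Edge.sign e = true →
      Edge.sign f = true → Closes C e f) : IsHomotopyBase C := by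
  intro x y p q
  obtain ⟨z, hyz, hz⟩ := exists_irreducible hR.1 y
  obtain ⟨z', hxz, hz'⟩ := exists_irreducible hR.1 x
  obtain ⟨n, hn⟩ := exists_isPositive (R := R) hyz
  obtain ⟨m, hm⟩ := exists_isPositive (R := R) hxz
  -- Rewriting in either direction preserves the normal form, so the ends of `p` have the same one.
  have key : z = z' := by
    clear q n hn
    induction p generalizing z with
    | nil => exact irreducible_unique hR.2 hyz hxz hz hz'
    | @cons y' y p e ih =>
      cases he : Edge.sign e with
      | true => exact ih z (.head (rewrites_of_edge e he) hyz) hz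
      | false =>
        have he' : Edge.sign (Quiver.reverse e) = true := congrArg (!·) he
        obtain ⟨t, ht, hi⟩ := exists_irreducible hR.1 y'
        exact (irreducible_unique hR.2 hyz (.head (rewrites_of_edge _ he') ht) hz hi).trans
          (ih t ht hi)
  subst key
  have h : Homotopic C (p.comp n) (q.comp n) :=
    (homotopic_comp_isPositive hR hC hz p m hm n hn).trans
      (homotopic_comp_isPositive hR hC hz q m hm n hn).symm
  have cancel : ∀ s : Quiver.Path x y, Homotopic C s ((s.comp n).comp n.reverse) := fun s => by
    rw [Quiver.Path.comp_assoc]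
    simpa using ((Homotopic.comp_reverse n).comp_left s).symm
  exact (cancel p).trans ((h.comp_right _).trans (cancel q).symm)

/-- The length of a word. -/
def wordLength (x : DerivationGraph R) : ℕ := FreeMonoid.length x

theorem wordLength_mul (x y : DerivationGraph R) :
    wordLength (x * y) = wordLength x + wordLength y :=
  FreeMonoid.length_mul x y

theorem eq_one_of_wordLength_eq_zero {x : DerivationGraph R} (h : wordLength x = 0) : x = 1 :=
  FreeMonoid.length_eq_zero.1 h

theorem mul_eq_mul_cases {a b c d : DerivationGraph R} (h : a * b = c * d) :
    (∃ m : DerivationGraph R, c = a * m ∧ b = m * d) ∨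
      ∃ m : DerivationGraph R, a = c * m ∧ d = m * b :=
  List.append_eq_append_iff.1 h

/-- A peak either consists of disjoint applications, closed by interchange, or is a translate of a
peak on the union of two overlapping left sides, of length at most the sum of theirs. -/
theorem closes_of_short (N : ℕ) (hN : ∀ r s : R, r.1.1.length + s.1.1.length ≤ N)
    (hC : ∀ {w x y : DerivationGraph R} (e : w ⟶ x) (f : w ⟶ y), Edge.sign e = true →
      Edge.sign f = true → wordLength w ≤ N → Closes C e f)
    {w x y : DerivationGraph R} (e : w ⟶ x) (f : w ⟶ y) (he : Edge.sign e = true)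
    (hf : Edge.sign f = true) : Closes C e f := by
  wlog hle : wordLength (Edge.left e) ≤ wordLength (Edge.left f) generalizing x y
  · exact (this f e hf he (le_of_not_ge hle)).symm
  obtain ⟨l₁, r, s₁, q₁, hw₁, hx⟩ := e
  obtain ⟨l₂, s, s₂, q₂, hw₂, hy⟩ := f
  change s₁ = true at he
  change s₂ = true at hf
  subst he hf
  change wordLength l₁ ≤ wordLength l₂ at hle
  obtain ⟨m, rfl, hm⟩ : ∃ m : DerivationGraph R,
      l₂ = l₁ * m ∧ side r true * q₁ = m * (side s true * q₂) := by
    have key : l₁ * (side r true * q₁) = l₂ * (side s true * q₂) := by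
      rw [← mul_assoc, ← mul_assoc, ← hw₁, ← hw₂]
    rcases mul_eq_mul_cases key with ⟨m, h, h'⟩ | ⟨m, h, h'⟩
    · exact ⟨m, h, h'⟩
    -- Here `l₁ = l₂ * m` although `l₁` is no longer than `l₂`.
    · have hm : m = 1 := by
        have := (congrArg wordLength h).symm.le.trans hle
        rw [wordLength_mul] at this
        exact eq_one_of_wordLength_eq_zero (by omega)
      rw [hm, mul_one] at h
      rw [hm, one_mul] at h'
      exact ⟨1, by rw [h, mul_one], by rw [h', one_mul]⟩
  clear hle
  have hlen : wordLength (side r true) + wordLength (side s true) ≤ N := hN r s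
  -- Three positions: `s` starts after `r` ends, `s` lies inside `r`, or `s` reaches the end of `r`
  -- or beyond.
  rcases mul_eq_mul_cases hm with ⟨m', h, h'⟩ | ⟨m', h, h'⟩
  · exact (closes_disjoint C
      (Edge.mk (x := side r true * m') 1 r true m' (by rw [one_mul]) rfl)
      (Edge.mk (x := side s true) 1 s true 1 (by rw [one_mul, mul_one]) rfl)
      rfl rfl).of_translate l₁ q₂
      (mul_one _).symm (h'.trans (mul_assoc _ _ _).symm) rfl rfl
      (congrArg (l₁ * ·) (h.trans (mul_one _).symm)) (one_mul _).symm rfl rfl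
  · rcases mul_eq_mul_cases h' with ⟨t, h₁, h₂⟩ | ⟨t, h₁, h₂⟩
    · refine (hC (w := side r true) (Edge.mk (R := R) 1 r true 1 ?_ rfl)
        (Edge.mk (R := R) m s true t ?_ rfl) rfl rfl ?_).of_translate l₁ q₁
        (mul_one _).symm (one_mul _).symm rfl rfl rfl h₂ rfl rfl
      · rw [one_mul, mul_one]
      · rw [h, h₁, mul_assoc]
      · omega
    · refine (hC (w := m * side s true) (Edge.mk (R := R) 1 r true t ?_ rfl)
        (Edge.mk (R := R) m s true 1 ?_ rfl) rfl rfl ?_).of_translate l₁ q₂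
        (mul_one _).symm h₂ rfl rfl rfl (one_mul _).symm rfl rfl
      · rw [one_mul, h, h₁, mul_assoc]
      · rw [mul_one]
      · rw [wordLength_mul]
        rw [h, wordLength_mul] at hlen
        omega

/-- The peaks of positive edges, given by the positions of the two rules. -/
abbrev PeakData (R : Set (FreeMonoid A × FreeMonoid A)) : Type u :=
  (DerivationGraph R × R × DerivationGraph R) ×
    (DerivationGraph R × R × DerivationGraph R)

theorem finite_peakData [Finite A] (hR : R.Finite) (N : ℕ) :
    {d : PeakData R | (wordLength d.1.1 ≤ N ∧ wordLength d.1.2.2 ≤ N) ∧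
      (wordLength d.2.1 ≤ N ∧ wordLength d.2.2.2 ≤ N)}.Finite := by
  have : Finite R := hR
  have hl : {l : DerivationGraph R | wordLength l ≤ N}.Finite := List.finite_length_le A N
  have h : ({t : DerivationGraph R × R × DerivationGraph R |
      wordLength t.1 ≤ N ∧ wordLength t.2.2 ≤ N}).Finite :=
    (hl.prod ((Set.finite_univ (α := R)).prod hl)).subset fun t ht => ⟨ht.1, trivial, ht.2⟩
  exact (h.prod h).subset fun d hd => hd

/-- Bounded words carry finitely many peaks. Confluence closes each one by some pair of positive
paths, and the resulting loops are put into `C`. -/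
theorem exists_finite_closes [Finite A] (hR : R.Finite) (hconf : IsConfluent R) (N : ℕ) :
    ∃ C : Set (ParallelPair R), C.Finite ∧
      ∀ {w x y : DerivationGraph R} (e : w ⟶ x) (f : w ⟶ y), Edge.sign e = true →
        Edge.sign f = true → wordLength w ≤ N → Closes C e f := by
  have hex : ∀ {w x y : DerivationGraph R} (e : w ⟶ x) (f : w ⟶ y), Edge.sign e = true →
      Edge.sign f = true → ∃ (z : DerivationGraph R) (p : Quiver.Path x z) (q : Quiver.Path y z),
        IsPositive p ∧ IsPositive q := by
    intro w x y e f he hf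
    obtain ⟨z, hx, hy⟩ := hconf w x y (.single (rewrites_of_edge e he))
      (.single (rewrites_of_edge f hf))
    obtain ⟨p, hp⟩ := exists_isPositive (R := R) hx
    obtain ⟨q, hq⟩ := exists_isPositive (R := R) hy
    exact ⟨z, p, q, hp, hq⟩
  choose Z P Q hP hQ using @hex
  let D := {d : PeakData R | ((wordLength d.1.1 ≤ N ∧ wordLength d.1.2.2 ≤ N) ∧
      (wordLength d.2.1 ≤ N ∧ wordLength d.2.2.2 ≤ N)) ∧
      d.1.1 * side d.1.2.1 true * d.1.2.2 = d.2.1 * side d.2.2.1 true * d.2.2.2}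
  have hD : D.Finite := (finite_peakData hR N).subset fun d hd => hd.1
  let edge₁ (d : D) : d.1.1.1 * side d.1.1.2.1 true * d.1.1.2.2 ⟶
      d.1.1.1 * side d.1.1.2.1 false * d.1.1.2.2 :=
    Edge.mk d.1.1.1 d.1.1.2.1 true d.1.1.2.2 rfl rfl
  let edge₂ (d : D) : d.1.1.1 * side d.1.1.2.1 true * d.1.1.2.2 ⟶
      d.1.2.1 * side d.1.2.2.1 false * d.1.2.2.2 :=
    Edge.mk d.1.2.1 d.1.2.2.1 true d.1.2.2.2 d.2.2 rfl
  have : Finite D := hD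
  refine ⟨Set.range fun d : D => (⟨_, _, (edge₁ d).toPath.comp (P (edge₁ d) (edge₂ d) rfl rfl),
    (edge₂ d).toPath.comp (Q (edge₁ d) (edge₂ d) rfl rfl)⟩ : ParallelPair R),
    Set.finite_range _, ?_⟩
  intro w x y e f he hf hw
  obtain ⟨l₁, r, s₁, q₁, hw₁, hx⟩ := e
  obtain ⟨l₂, s, s₂, q₂, hw₂, hy⟩ := f
  change s₁ = true at he
  change s₂ = true at hf
  subst he hf hx hy hw₁
  have len₁ := hw
  have len₂ := hw
  rw [wordLength_mul, wordLength_mul] at len₁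
  rw [hw₂, wordLength_mul, wordLength_mul] at len₂
  let d : D := ⟨((l₁, r, q₁), (l₂, s, q₂)),
    ⟨⟨by dsimp only; omega, by dsimp only; omega⟩, by dsimp only; omega, by dsimp only; omega⟩,
    hw₂⟩
  exact ⟨_, P (edge₁ d) (edge₂ d) rfl rfl, Q (edge₁ d) (edge₂ d) rfl rfl, hP _ _ _ _, hQ _ _ _ _,
    Homotopic.of_mem (Set.mem_range_self d)⟩

end Squier

end DerivationGraph

/-- **Squier's theorem**: a finite complete rewriting system has a finite homotopy base. -/
theorem presentationFDT_of_isCompleteRewriting {A : Type u} [Finite A]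
    {R : Set (FreeMonoid A × FreeMonoid A)} (hfin : R.Finite) (hR : IsCompleteRewriting R) :
    PresentationFDT R := by
  obtain ⟨N, hN⟩ : ∃ N, ∀ r ∈ R, r.1.length ≤ N := by
    obtain ⟨N, hN⟩ := (hfin.image fun r => r.1.length).bddAbove
    exact ⟨N, fun r hr => hN ⟨r, hr, rfl⟩⟩
  obtain ⟨C, hC, hcl⟩ := DerivationGraph.exists_finite_closes hfin hR.2 (N + N)
  exact ⟨C, hC, DerivationGraph.isHomotopyBase_of_closes hR
    (DerivationGraph.closes_of_short (N + N) (fun r s => add_le_add (hN _ r.2) (hN _ s.2)) hcl)⟩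

theorem hasFDT_of_hasFiniteCompleteRewriting {S : Type v} [Monoid S]
    (h : HasFiniteCompleteRewriting S) : HasFDT S := by
  obtain ⟨A, R, hA, hR, hc, e⟩ := h
  exact ⟨A, R, hA, hR, e, presentationFDT_of_isCompleteRewriting hR hc⟩

/-! ### Complete rewriting systems from normal forms -/

theorem Rewrites.mul_left {A : Type u} {R : Set (FreeMonoid A × FreeMonoid A)}
    {x y : FreeMonoid A} (h : Rewrites R x y) (w : FreeMonoid A) :
    Rewrites R (w * x) (w * y) := by
  obtain ⟨r, hr, w₁, w₂, rfl, rfl⟩ := h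
  exact ⟨r, hr, w * w₁, w₂, by simp only [mul_assoc], by simp only [mul_assoc]⟩

theorem Rewrites.mul_right {A : Type u} {R : Set (FreeMonoid A × FreeMonoid A)}
    {x y : FreeMonoid A} (h : Rewrites R x y) (w : FreeMonoid A) :
    Rewrites R (x * w) (y * w) := by
  obtain ⟨r, hr, w₁, w₂, rfl, rfl⟩ := h
  exact ⟨r, hr, w₁, w₂ * w, by simp only [mul_assoc], by simp only [mul_assoc]⟩

theorem Rewrites.of_mem {A : Type u} {R : Set (FreeMonoid A × FreeMonoid A)}
    {x y : FreeMonoid A} (h : (x, y) ∈ R) : Rewrites R x y :=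
  ⟨(x, y), h, 1, 1, by simp, by simp⟩

theorem reduces_mul_left {A : Type u} {R : Set (FreeMonoid A × FreeMonoid A)}
    {x y : FreeMonoid A} (h : Relation.ReflTransGen (Rewrites R) x y) (w : FreeMonoid A) :
    Relation.ReflTransGen (Rewrites R) (w * x) (w * y) :=
  h.lift (w * ·) fun _ _ h => h.mul_left w

theorem reduces_mul_right {A : Type u} {R : Set (FreeMonoid A × FreeMonoid A)}
    {x y : FreeMonoid A} (h : Relation.ReflTransGen (Rewrites R) x y) (w : FreeMonoid A) :
    Relation.ReflTransGen (Rewrites R) (x * w) (y * w) :=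
  h.lift (· * w) fun _ _ h => h.mul_right w

theorem isNoetherianRewriting_of_lt {A : Type u} {R : Set (FreeMonoid A × FreeMonoid A)}
    (μ : FreeMonoid A → ℕ) (h : ∀ x y, Rewrites R x y → μ y < μ x) : IsNoetherianRewriting R := by
  rintro ⟨f, hf⟩
  have hle : ∀ n, μ (f n) + n ≤ μ (f 0) := by
    intro n
    induction n with
    | zero => rfl
    | succ n ih =>
      have := h _ _ (hf n)
      omega
  have := hle (μ (f 0) + 1)
  omega

theorem mk_eq_of_reduces {A : Type u} {R : Set (FreeMonoid A × FreeMonoid A)}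
    {x y : FreeMonoid A} (h : Relation.ReflTransGen (Rewrites R) x y) :
    PresentedMonoid.mk (fun x y => (x, y) ∈ R) x = PresentedMonoid.mk _ y := by
  induction h with
  | refl => rfl
  | tail _ h ih =>
    obtain ⟨r, hr, w₁, w₂, rfl, rfl⟩ := h
    rw [ih, map_mul, map_mul, map_mul, map_mul,
      PresentedMonoid.mk_eq_mk_of_rel (rels := fun x y => (x, y) ∈ R) (x := r.1) (y := r.2) hr]

/-- A noetherian finite system all of whose words reduce to a normal form determined by the
element of `S` they represent is a finite complete rewriting system for `S`. -/
theorem hasFiniteCompleteRewriting_of_normalForm {S : Type v} [Monoid S] {A : Type} [Finite A]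
    {R : Set (FreeMonoid A × FreeMonoid A)} (hfin : R.Finite) (hR : IsNoetherianRewriting R)
    (π : FreeMonoid A →* S) (hπ : Function.Surjective π) (hrel : ∀ r ∈ R, π r.1 = π r.2)
    (N : S → FreeMonoid A) (hN : ∀ w, Relation.ReflTransGen (Rewrites R) w (N (π w))) :
    HasFiniteCompleteRewriting S := by
  have hstep : ∀ x y, Relation.ReflTransGen (Rewrites R) x y → π x = π y := by
    intro x y h
    induction h with
    | refl => rfl
    | tail _ h ih =>
      obtain ⟨r, hr, w₁, w₂, rfl, rfl⟩ := h
      rw [ih, map_mul, map_mul, map_mul, map_mul, hrel r hr]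
  refine ⟨A, R, inferInstance, hfin, ⟨hR, fun w x y hx hy => ⟨N (π w), ?_, ?_⟩⟩, ⟨?_⟩⟩
  · rw [hstep w x hx]
    exact hN x
  · rw [hstep w y hy]
    exact hN y
  · let φ : MonoidOf R →* S := Con.lift _ π (Con.conGen_le.2 fun x y h => hrel (x, y) h)
    have hφ : ∀ w, φ (PresentedMonoid.mk _ w) = π w := fun w => rfl
    refine MulEquiv.ofBijective φ ⟨fun x y h => ?_, fun s => ?_⟩
    · obtain ⟨x, rfl⟩ := PresentedMonoid.surjective_mk x
      obtain ⟨y, rfl⟩ := PresentedMonoid.surjective_mk y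
      rw [hφ, hφ] at h
      rw [mk_eq_of_reduces (hN x), mk_eq_of_reduces (hN y), h]
    · obtain ⟨w, rfl⟩ := hπ s
      exact ⟨PresentedMonoid.mk _ w, hφ w⟩

theorem HasFiniteCompleteRewriting.of_mulEquiv {S : Type u} {T : Type v} [Monoid S] [Monoid T]
    (h : HasFiniteCompleteRewriting S) (e : S ≃* T) : HasFiniteCompleteRewriting T := by
  obtain ⟨A, R, hA, hR, hc, ⟨f⟩⟩ := h
  exact ⟨A, R, hA, hR, hc, ⟨f.trans e⟩⟩

theorem hasFiniteCompleteRewriting_unit : HasFiniteCompleteRewriting Unit := by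
  refine hasFiniteCompleteRewriting_of_normalForm (A := Empty) (R := ∅) Set.finite_empty
    (isNoetherianRewriting_of_lt (fun _ => 0) ?_) 1 (fun _ => ⟨1, rfl⟩) (by simp) (fun _ => 1)
    fun w => ?_
  · rintro x y ⟨r, hr, -⟩
    exact hr.elim
  · rw [show w = 1 from by cases w using FreeMonoid.casesOn with
      | one => rfl
      | of_mul x => exact x.elim]

/-! ### The free group -/

/-- The free reductions `x x⁻¹ → 1`. -/
def freeReductions (α : Type) : Set (FreeMonoid (α × Bool) × FreeMonoid (α × Bool)) :=
  Set.range fun p : α × Bool => (FreeMonoid.of p * FreeMonoid.of (p.1, !p.2), 1)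

theorem rewrites_freeReductions_of_step {α : Type} {x y : List (α × Bool)}
    (h : FreeGroup.Red.Step x y) :
    Rewrites (freeReductions α) (FreeMonoid.ofList x) (FreeMonoid.ofList y) := by
  cases h with
  | @not L₁ L₂ x b =>
    refine ⟨_, ⟨(x, b), rfl⟩, FreeMonoid.ofList L₁, FreeMonoid.ofList L₂, ?_, ?_⟩
    · change L₁ ++ (x, b) :: (x, !b) :: L₂ = (L₁ ++ [(x, b), (x, !b)]) ++ L₂
      simp
    · change L₁ ++ L₂ = (L₁ ++ []) ++ L₂
      simp

theorem hasFiniteCompleteRewriting_freeGroup (α : Type) [Finite α] :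
    HasFiniteCompleteRewriting (FreeGroup α) := by
  classical
  let π : FreeMonoid (α × Bool) →* FreeGroup α :=
    { toFun := fun w => FreeGroup.mk w.toList
      map_one' := rfl
      map_mul' := fun x y => by rw [FreeMonoid.toList_mul, FreeGroup.mul_mk] }
  refine hasFiniteCompleteRewriting_of_normalForm (R := freeReductions α) (Set.finite_range _)
    (isNoetherianRewriting_of_lt FreeMonoid.length ?_) π ?_ ?_
    (fun g => FreeMonoid.ofList g.toWord) fun w => ?_
  · rintro x y ⟨_, ⟨p, rfl⟩, w₁, w₂, rfl, rfl⟩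
    simp only [FreeMonoid.length_mul, FreeMonoid.length_of, FreeMonoid.length_one]
    omega
  · rintro ⟨L⟩
    exact ⟨FreeMonoid.ofList L, rfl⟩
  · rintro _ ⟨p, rfl⟩
    exact Quot.sound (FreeGroup.Red.Step.not (L₁ := []) (L₂ := []) (x := p.1) (b := p.2))
  · change Relation.ReflTransGen _ w (FreeGroup.mk w.toList).toWord
    rw [FreeGroup.toWord_mk]
    -- The normal form is the reduced word, reached from `w` by free reductions.
    exact Relation.ReflTransGen.lift (p := Rewrites _) FreeMonoid.ofList
      (fun _ _ => rewrites_freeReductions_of_step) _ _ (FreeGroup.reduce.red (L := w.toList))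

/-! ### The free abelian group of rank two -/

/-- Signed generators of `ℤ²`: `(false, ε)` is the first, `(true, ε)` the second generator, the
inverse ones having `ε = false`. -/
def abelianRules : Set (FreeMonoid (Bool × Bool) × FreeMonoid (Bool × Bool)) :=
  freeReductions Bool ∪ Set.range fun p : Bool × Bool =>
    (FreeMonoid.of (true, p.1) * FreeMonoid.of (false, p.2),
      FreeMonoid.of (false, p.2) * FreeMonoid.of (true, p.1))

/-- A strictly monotone interpretation of words that decreases along `abelianRules`. -/
def abelianWeight : Bool × Bool → ℕ → ℕ
  | (false, _), n => n + 1
  | (true, _), n => 2 * n + 1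

theorem abelianWeight_strictMono (p : Bool × Bool) : StrictMono (abelianWeight p) := by
  rcases p with ⟨_ | _, b⟩ <;> intro m n h <;> simp only [abelianWeight] <;> omega

theorem foldr_abelianWeight_strictMono (L : List (Bool × Bool)) :
    StrictMono fun n => L.foldr abelianWeight n := by
  induction L with
  | nil => exact strictMono_id
  | cons p L ih => exact (abelianWeight_strictMono p).comp ih

/-- A suffix enters only through its value `n`, and a prefix is strictly monotone, so it is enough
to compare the two sides of a rule at `n`. For a swap this is 2(n + 1) + 1 > (2n + 1) + 1. -/
theorem isNoetherianRewriting_abelianRules : IsNoetherianRewriting abelianRules := by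
  refine isNoetherianRewriting_of_lt (fun w => w.toList.foldr abelianWeight 0) ?_
  rintro x y ⟨r, hr, w₁, w₂, rfl, rfl⟩
  simp only [FreeMonoid.toList_mul, List.foldr_append]
  refine foldr_abelianWeight_strictMono _ ?_
  generalize List.foldr abelianWeight 0 _ = n
  rcases hr with ⟨⟨_ | _, b⟩, rfl⟩ | ⟨p, rfl⟩ <;>
    simp only [FreeMonoid.toList_mul, FreeMonoid.toList_of, FreeMonoid.toList_one,
      List.foldr_append, List.foldr_cons, List.foldr_nil, abelianWeight] <;> omega

/-- The image of a signed generator in `ℤ²`. -/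
def signedUnit : Bool × Bool → ℤ × ℤ
  | (false, true) => (1, 0)
  | (false, false) => (-1, 0)
  | (true, true) => (0, 1)
  | (true, false) => (0, -1)

/-- The word `x ^ i` for a generator `x` and an integer `i`. -/
def signedPow (x : Bool) (i : ℤ) : FreeMonoid (Bool × Bool) :=
  FreeMonoid.of (x, decide (0 ≤ i)) ^ i.natAbs

theorem signedPow_of_nonneg (x : Bool) {i : ℤ} (h : 0 ≤ i) :
    signedPow x i = FreeMonoid.of (x, true) ^ i.natAbs := by
  rw [signedPow, decide_eq_true h]

theorem signedPow_of_nonpos (x : Bool) {i : ℤ} (h : i ≤ 0) :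
    signedPow x i = FreeMonoid.of (x, false) ^ i.natAbs := by
  rcases h.eq_or_lt with rfl | h
  -- At `i = 0` the sign chosen by `signedPow` is immaterial, since the power is empty.
  · rfl
  · rw [signedPow, decide_eq_false (not_le.2 h)]

theorem reduces_of_mul_signedPow (x ε : Bool) (i : ℤ) :
    Relation.ReflTransGen (Rewrites abelianRules) (FreeMonoid.of (x, ε) * signedPow x i)
      (signedPow x (i + if ε then 1 else -1)) := by
  have cancel : ∀ n, Rewrites abelianRules
      (FreeMonoid.of (x, ε) * FreeMonoid.of (x, !ε) ^ (n + 1)) (FreeMonoid.of (x, !ε) ^ n) := by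
    intro n
    have := (Rewrites.of_mem (R := abelianRules) (.inl ⟨(x, ε), rfl⟩)).mul_right
      (FreeMonoid.of (x, !ε) ^ n)
    rwa [mul_assoc, ← pow_succ', one_mul] at this
  cases ε with
  | true =>
    rw [if_pos rfl]
    rcases le_or_gt 0 i with h | h
    · rw [signedPow_of_nonneg x h, signedPow_of_nonneg x (by omega : 0 ≤ i + 1), ← pow_succ',
        show (i + 1).natAbs = i.natAbs + 1 by omega]
    · rw [signedPow_of_nonpos x h.le, signedPow_of_nonpos x (by omega : i + 1 ≤ 0),
        show i.natAbs = (i + 1).natAbs + 1 by omega]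
      exact .single (cancel _)
  | false =>
    rw [if_neg Bool.false_ne_true]
    rcases le_or_gt i 0 with h | h
    · rw [signedPow_of_nonpos x h, signedPow_of_nonpos x (by omega : i + -1 ≤ 0), ← pow_succ',
        show (i + -1).natAbs = i.natAbs + 1 by omega]
    · rw [signedPow_of_nonneg x h.le, signedPow_of_nonneg x (by omega : 0 ≤ i + -1),
        show i.natAbs = (i + -1).natAbs + 1 by omega]
      exact .single (cancel _)

theorem reduces_swap (ε : Bool) (i : ℤ) :
    Relation.ReflTransGen (Rewrites abelianRules) (FreeMonoid.of (true, ε) * signedPow false i)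
      (signedPow false i * FreeMonoid.of (true, ε)) := by
  rw [signedPow]
  induction i.natAbs with
  | zero => simpa using .refl
  | succ n ih =>
    rw [pow_succ, ← mul_assoc]
    refine (reduces_mul_right ih _).trans ?_
    rw [mul_assoc, mul_assoc]
    exact .single ((Rewrites.of_mem (.inr ⟨(ε, decide (0 ≤ i)), rfl⟩)).mul_left _)

theorem hasFiniteCompleteRewriting_int_prod_int :
    HasFiniteCompleteRewriting (Multiplicative (ℤ × ℤ)) := by
  let π : FreeMonoid (Bool × Bool) →* Multiplicative (ℤ × ℤ) :=
    FreeMonoid.lift fun p => Multiplicative.ofAdd (signedUnit p)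
  -- The swaps move the first generator to the left, which dictates this order of the two powers.
  let N : Multiplicative (ℤ × ℤ) → FreeMonoid (Bool × Bool) := fun g =>
    signedPow false g.toAdd.1 * signedPow true g.toAdd.2
  have hN : ∀ w, Relation.ReflTransGen (Rewrites abelianRules) w (N (π w)) := by
    intro w
    induction w using FreeMonoid.inductionOn' with
    | one => exact .refl
    | of_mul p w ih =>
      refine (reduces_mul_left ih _).trans ?_
      obtain ⟨_ | _, ε⟩ := p
      · change Relation.ReflTransGen _ _ (signedPow false _ * signedPow true _)
        have := reduces_mul_right (reduces_of_mul_signedPow false ε (π w).toAdd.1)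
          (signedPow true (π w).toAdd.2)
        rw [mul_assoc] at this
        convert this using 3
        · cases ε <;> simp [π, signedUnit, add_comm]
        · cases ε <;> simp [π, signedUnit]
      · change Relation.ReflTransGen _ _ (signedPow false _ * signedPow true _)
        have h₁ := reduces_mul_right (reduces_swap ε (π w).toAdd.1)
          (signedPow true (π w).toAdd.2)
        have h₂ := reduces_mul_left (reduces_of_mul_signedPow true ε (π w).toAdd.2)
          (signedPow false (π w).toAdd.1)
        rw [mul_assoc] at h₁
        rw [← mul_assoc] at h₂
        convert h₁.trans h₂ using 3
        · cases ε <;> simp [π, signedUnit]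
        · cases ε <;> simp [π, signedUnit, add_comm]
  refine hasFiniteCompleteRewriting_of_normalForm
    ((Set.finite_range _).union (Set.finite_range _)) isNoetherianRewriting_abelianRules π ?_ ?_
    N hN
  · have hpow : ∀ (x : Bool) (i : ℤ),
        π (signedPow x i) = Multiplicative.ofAdd (if x then (0, i) else (i, 0)) := by
      intro x i
      rw [signedPow, map_pow, FreeMonoid.lift_eval_of, ← ofAdd_nsmul]
      congr 1
      rcases le_or_gt 0 i with h | h
      · cases x <;> simp [signedUnit, h]
      · cases x <;> simp [signedUnit, not_le.2 h, abs_of_neg h]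
    intro g
    refine ⟨N g, ?_⟩
    rw [map_mul, hpow, hpow, ← ofAdd_add]
    simp
  · rintro _ (⟨⟨_ | _, _ | _⟩, rfl⟩ | ⟨⟨_ | _, _ | _⟩, rfl⟩) <;> rfl

theorem hasFiniteCompleteRewriting_freeAbelianGroup :
    HasFiniteCompleteRewriting (Multiplicative (FreeAbelianGroup (Fin 2))) :=
  hasFiniteCompleteRewriting_int_prod_int.of_mulEquiv <| AddEquiv.toMultiplicative <|
    (((FreeAbelianGroup.equivFinsupp (Fin 2)).trans
      (Finsupp.linearEquivFunOnFinite ℤ ℤ (Fin 2)).toAddEquiv).trans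
      (LinearEquiv.finTwoArrow ℤ ℤ).toAddEquiv).symm

/-! ### Layered monoids -/

/-- The monoid `G ⊔ Q ⊔ {0}` attached to a homomorphism `G → Q`: the group `G` acts on `Q` through
translations from both sides, and `Q · Q = 0`. -/
inductive LayeredMonoid {G : Type u} {Q : Type v} [Group G] [CommGroup Q] (f : G →* Q) :
    Type (max u v)
  | unit (g : G)
  | mid (q : Q)
  | zero

namespace LayeredMonoid

variable {G : Type u} {Q : Type v} [Group G] [CommGroup Q] {f : G →* Q}

/-- Multiplication in the layered monoid. -/
def mul : LayeredMonoid f → LayeredMonoid f → LayeredMonoid f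
  | unit g, unit g' => unit (g * g')
  | unit g, mid q => mid (f g * q)
  | mid q, unit g => mid (q * f g)
  | mid _, mid _ => zero
  | zero, _ => zero
  | _, zero => zero

instance : Mul (LayeredMonoid f) := ⟨mul⟩

instance : One (LayeredMonoid f) := ⟨unit 1⟩

theorem one_def : (1 : LayeredMonoid f) = unit 1 := rfl

@[simp] theorem unit_mul_unit (g g' : G) : (unit g * unit g' : LayeredMonoid f) = unit (g * g') :=
  rfl

@[simp] theorem unit_mul_mid (g : G) (q : Q) : (unit g * mid q : LayeredMonoid f) = mid (f g * q) :=
  rfl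

@[simp] theorem mid_mul_unit (g : G) (q : Q) : (mid q * unit g : LayeredMonoid f) = mid (q * f g) :=
  rfl

@[simp] theorem mid_mul_mid (q q' : Q) : (mid q * mid q' : LayeredMonoid f) = zero := rfl

@[simp] theorem zero_mul (x : LayeredMonoid f) : zero * x = zero := rfl

@[simp] theorem mul_zero (x : LayeredMonoid f) : x * zero = zero := by
  cases x <;> rfl

instance : Monoid (LayeredMonoid f) where
  mul_assoc x y z := by
    cases x <;> cases y <;> cases z <;> simp [mul_assoc]
  one_mul x := by
    cases x <;> simp [one_def]
  mul_one x := by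
    cases x <;> simp [one_def]

variable (f) in
/-- The inclusion of the group of units. -/
def unitHom : G →* LayeredMonoid f where
  toFun := unit
  map_one' := rfl
  map_mul' _ _ := rfl

@[simp] theorem unitHom_apply (g : G) : unitHom f g = unit g := rfl

theorem hClass_unit (g : G) : hClass (unit g : LayeredMonoid f) = Set.range unit := by
  ext y
  constructor
  · rintro ⟨h, -⟩
    obtain ⟨⟨s, hs⟩, -⟩ := greenR_iff.1 h
    cases y <;> cases s <;> simp at hs ⊢
  · rintro ⟨g', rfl⟩
    exact ⟨greenR_iff.2 ⟨⟨unit (g'⁻¹ * g), by simp⟩, unit (g⁻¹ * g'), by simp⟩,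
      greenL_iff.2 ⟨⟨unit (g * g'⁻¹), by simp⟩, unit (g' * g⁻¹), by simp⟩⟩

/-- Multiplication never climbs from a lower layer to a higher one, and translations by `f G = Q`
are transitive on the middle layer. -/
theorem hClass_mid (hf : Function.Surjective f) (q : Q) :
    hClass (mid q : LayeredMonoid f) = Set.range mid := by
  ext y
  constructor
  · rintro ⟨h, -⟩
    obtain ⟨⟨s, hs⟩, ⟨t, ht⟩⟩ := greenR_iff.1 h
    cases y <;> cases s <;> cases t <;> simp at hs ht ⊢
  · rintro ⟨q', rfl⟩
    obtain ⟨g, hg⟩ := hf (q'⁻¹ * q)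
    obtain ⟨g', hg'⟩ := hf (q⁻¹ * q')
    exact ⟨greenR_iff.2 ⟨⟨unit g, by simp [hg]⟩, unit g', by simp [hg']⟩,
      greenL_iff.2 ⟨⟨unit g, by simp [hg]⟩, unit g', by simp [hg']⟩⟩

theorem hClass_zero : hClass (zero : LayeredMonoid f) = {zero} := by
  ext y
  constructor
  · rintro ⟨h, -⟩
    obtain ⟨-, s, hs⟩ := greenR_iff.1 h
    exact hs.symm
  · rintro rfl
    exact mem_hClass_self _

theorem unit_mem_hStab (hf : Function.Surjective f) (g : G) (x : LayeredMonoid f) :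
    unit g ∈ hStab x := by
  change (fun y => y * unit g) '' hClass x = hClass x
  cases x with
  | unit a =>
    rw [hClass_unit]
    ext y
    constructor
    · rintro ⟨_, ⟨b, rfl⟩, rfl⟩
      exact ⟨_, rfl⟩
    · rintro ⟨b, rfl⟩
      exact ⟨unit (b * g⁻¹), ⟨_, rfl⟩, by simp⟩
  | mid q =>
    rw [hClass_mid hf]
    ext y
    constructor
    · rintro ⟨_, ⟨b, rfl⟩, rfl⟩
      exact ⟨_, rfl⟩
    · rintro ⟨b, rfl⟩
      exact ⟨mid (b * (f g)⁻¹), ⟨_, rfl⟩, by simp⟩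
  | zero =>
    rw [hClass_zero, Set.image_singleton, zero_mul]

/-- The H-class of `x` is a single orbit of the units acting on the right, and `x * s` lies in it.
-/
theorem exists_mul_unit_eq (hf : Function.Surjective f) {x s : LayeredMonoid f}
    (hs : s ∈ hStab x) : ∃ g : G, x * s = x * unit g := by
  have h := mul_mem_hClass hs (mem_hClass_self x)
  cases x with
  | unit a =>
    rw [hClass_unit] at h
    obtain ⟨b, hb⟩ := h
    exact ⟨a⁻¹ * b, by simp [← hb]⟩
  | mid q =>
    rw [hClass_mid hf] at h
    obtain ⟨q', hq'⟩ := h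
    obtain ⟨g, hg⟩ := hf (q⁻¹ * q')
    exact ⟨g, by simp [← hq', hg]⟩
  | zero => exact ⟨1, rfl⟩

end LayeredMonoid

/-! ### Schützenberger groups -/

section Schutzenberger

variable {S : Type u} {T : Type v} [Monoid S] [Monoid T]

theorem GreenH.map {x y : S} (h : GreenH x y) (e : S →* T) : GreenH (e x) (e y) := by
  obtain ⟨⟨s, hs⟩, t, ht⟩ := greenR_iff.1 h.1
  obtain ⟨⟨s', hs'⟩, t', ht'⟩ := greenL_iff.1 h.2
  exact ⟨greenR_iff.2 ⟨⟨e s, by rw [← map_mul, hs]⟩, e t, by rw [← map_mul, ht]⟩,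
    greenL_iff.2 ⟨⟨e s', by rw [← map_mul, hs']⟩, e t', by rw [← map_mul, ht']⟩⟩

theorem hClass_map (e : S ≃* T) (x : S) : hClass (e x) = e '' hClass x := by
  ext y
  constructor
  · intro h
    refine ⟨e.symm y, ?_, e.apply_symm_apply y⟩
    have h' := GreenH.map (show GreenH y (e x) from h) (e.symm : T →* S)
    rwa [MonoidHom.coe_coe, e.symm_apply_apply] at h'
  · rintro ⟨z, hz, rfl⟩
    exact GreenH.map hz (e : S →* T)

theorem mem_hStab_map_iff (e : S ≃* T) {x s : S} : e s ∈ hStab (e x) ↔ s ∈ hStab x := by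
  change (fun y => y * e s) '' hClass (e x) = hClass (e x) ↔
    (fun y => y * s) '' hClass x = hClass x
  rw [hClass_map, Set.image_image]
  simp only [← map_mul]
  rw [← Set.image_image (f := fun y => y * s) (g := e), e.injective.image_injective.eq_iff]

/-- A recognition principle for Schützenberger groups. -/
theorem nonempty_schutzenbergerGroup_mulEquiv {G Q : Type*} [Group G] [Group Q] (θ : G →* S)
    (f : G →* Q) (hf : Function.Surjective f) (x : S) (hθ : ∀ g, θ g ∈ hStab x)
    (hsurj : ∀ s ∈ hStab x, ∃ g, x * s = x * θ g) (hker : ∀ g, x * θ g = x ↔ f g = 1) :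
    Nonempty (SchutzenbergerGroup x ≃* Q) := by
  let Θ : G →* SchutzenbergerGroup x := (schutzenbergerCon x).mk'.comp (θ.codRestrict _ hθ)
  have hΘ : Function.Surjective Θ := by
    intro y
    induction y using Con.induction_on with
    | H s =>
      obtain ⟨g, hg⟩ := hsurj s s.2
      exact ⟨g, (Con.eq _).2 hg.symm⟩
  have hk : Θ.ker = f.ker := by
    ext g
    rw [MonoidHom.mem_ker, MonoidHom.mem_ker, ← hker]
    refine (Con.eq _).trans ?_
    change x * θ g = x * 1 ↔ _
    rw [mul_one]
  exact ⟨(QuotientGroup.quotientKerEquivOfSurjective Θ hΘ).symm.trans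
    ((QuotientGroup.quotientMulEquivOfEq hk).trans
      (QuotientGroup.quotientKerEquivOfSurjective f hf))⟩

namespace LayeredMonoid

variable {G Q : Type*} [Group G] [CommGroup Q] {f : G →* Q} 
  (e : S ≃* LayeredMonoid f) (x : S)

/-- Units already realise the whole Schützenberger group, which is thus `G` modulo the elements that
fix `e x`. -/
theorem nonempty_schutzenbergerGroup_mulEquiv_of_ker (hf : Function.Surjective f) {K : Type*} [Group K] (k : G →* K)
    (hk : Function.Surjective k) (hker : ∀ g, e x * unit g = e x ↔ k g = 1) :
    Nonempty (SchutzenbergerGroup x ≃* K) := by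
  refine nonempty_schutzenbergerGroup_mulEquiv ((e.symm : LayeredMonoid f →* S).comp (unitHom f))
    k hk x (fun g => ?_) (fun s hs => ?_) fun g => ?_
  · rw [← mem_hStab_map_iff e]
    simpa using unit_mem_hStab hf g (e x)
  · obtain ⟨g, hg⟩ := exists_mul_unit_eq hf ((mem_hStab_map_iff e).2 hs)
    refine ⟨g, e.injective ?_⟩
    simpa using hg
  · rw [← hker, ← e.injective.eq_iff]
    simp

theorem schutzenbergerGroup_unit {g : G} (hf : Function.Surjective f) (hx : e x = unit g) :
    Nonempty (SchutzenbergerGroup x ≃* G) :=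
  nonempty_schutzenbergerGroup_mulEquiv_of_ker e x hf (MonoidHom.id G) Function.surjective_id
    fun g' => by simp [hx]

theorem schutzenbergerGroup_mid {q : Q} (hf : Function.Surjective f) (hx : e x = mid q) :
    Nonempty (SchutzenbergerGroup x ≃* Q) :=
  nonempty_schutzenbergerGroup_mulEquiv_of_ker e x hf f hf fun g' => by simp [hx]

theorem schutzenbergerGroup_zero (hf : Function.Surjective f) (hx : e x = zero) :
    Nonempty (SchutzenbergerGroup x ≃* Unit) :=
  nonempty_schutzenbergerGroup_mulEquiv_of_ker e x hf 1 (fun _ => ⟨1, rfl⟩) fun g' => by simp [hx]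

end LayeredMonoid

end Schutzenberger

/-! ### The structure of the monoid `M` -/

/-- The abelianization map of the free group of rank two. -/
abbrev abHom : FreeGroup (Fin 2) →* Abelianization (FreeGroup (Fin 2)) := Abelianization.of

theorem abHom_surjective : Function.Surjective abHom := QuotientGroup.mk_surjective

/-- The model `F₂ ⊔ ℤ² ⊔ {0}` of the monoid `M`. -/
abbrev ModelM : Type := LayeredMonoid abHom

namespace MonoidM

open LayeredMonoid

/-- The generators of `M` in its model. -/
def genModel : Gen → ModelM
  | .a => unit (FreeGroup.of 0)
  | .a' => unit (FreeGroup.of 0)⁻¹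
  | .b => unit (FreeGroup.of 1)
  | .b' => unit (FreeGroup.of 1)⁻¹
  | .h => mid 1

theorem lift_genModel_units {x : FreeMonoid Gen} (hx : x ∈ Gen.units) :
    ∃ g, FreeMonoid.lift genModel x = unit g := by
  rcases hx with rfl | rfl | rfl | rfl <;> exact ⟨_, rfl⟩

theorem lift_genModel_H : FreeMonoid.lift genModel Gen.H = mid 1 := rfl

theorem lift_genModel_relations (x y : FreeMonoid Gen) (h : (x, y) ∈ Gen.relations) :
    FreeMonoid.lift genModel x = FreeMonoid.lift genModel y := by
  rcases h with (((h | ⟨z, hz, h⟩) | ⟨z, hz, w, hw, h⟩) | ⟨z, hz, h⟩) | h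
  · rcases h with h | h | h | h <;> obtain ⟨rfl, rfl⟩ := Prod.ext_iff.1 h <;>
      simp [genModel, one_def]
  · obtain ⟨rfl, rfl⟩ := Prod.ext_iff.1 h
    obtain ⟨g, hg⟩ := lift_genModel_units hz
    simp [hg, lift_genModel_H]
  · obtain ⟨rfl, rfl⟩ := Prod.ext_iff.1 h
    obtain ⟨g, hg⟩ := lift_genModel_units hz
    obtain ⟨g', hg'⟩ := lift_genModel_units hw
    simp [hg, hg', lift_genModel_H, mul_comm]
  · obtain ⟨rfl, rfl⟩ := Prod.ext_iff.1 h
    obtain ⟨g, hg⟩ := lift_genModel_units hz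
    simp [hg, lift_genModel_H, pow_two]
  · obtain ⟨rfl, rfl⟩ := Prod.ext_iff.1 h
    simp [lift_genModel_H, pow_succ]

/-- The homomorphism from `M` to its model. -/
def toModel : MonoidM →* ModelM :=
  PresentedMonoid.lift genModel lift_genModel_relations

/-- The image of a word in `M`. -/
abbrev word : FreeMonoid Gen →* MonoidM := PresentedMonoid.mk _

/-- A generator as an element of `M`. -/
def gen (x : Gen) : MonoidM := word (FreeMonoid.of x)

theorem word_H : word Gen.H = gen .h := rfl

theorem toModel_gen (x : Gen) : toModel (gen x) = genModel x := rfl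

theorem word_eq {x y : FreeMonoid Gen} (h : (x, y) ∈ Gen.relations) : word x = word y :=
  PresentedMonoid.mk_eq_mk_of_rel (rels := fun x y => (x, y) ∈ Gen.relations) h

/-- The units of `M` given by `a` and `b`. -/
def genUnit (i : Fin 2) : MonoidMˣ :=
  if i = 0 then
    ⟨gen .a, gen .a', word_eq (.inl (.inl (.inl (.inl (by simp))))),
      word_eq (.inl (.inl (.inl (.inl (by simp)))))⟩
  else
    ⟨gen .b, gen .b', word_eq (.inl (.inl (.inl (.inl (by simp))))),
      word_eq (.inl (.inl (.inl (.inl (by simp)))))⟩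

theorem genUnit_mul_h (i : Fin 2) : (genUnit i : MonoidM) * gen .h = gen .h * genUnit i := by
  have h : ∀ x ∈ Gen.units, word x * gen .h = gen .h * word x := fun x hx =>
    (map_mul word _ _).symm.trans ((word_eq (.inl (.inl (.inl (.inr ⟨x, hx, rfl⟩))))).trans
      (map_mul word _ _))
  fin_cases i
  · exact h _ (by simp [Gen.units])
  · exact h _ (by simp [Gen.units])

theorem h_mul_genUnit_mul (i j : Fin 2) :
    gen .h * (genUnit i : MonoidM) * genUnit j = gen .h * (genUnit j : MonoidM) * genUnit i := by
  have h : ∀ x ∈ Gen.units, ∀ y ∈ Gen.units,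
      gen .h * word x * word y = gen .h * word y * word x := fun x hx y hy => by
    have := word_eq (.inl (.inl (.inr ⟨x, hx, y, hy, rfl⟩)))
    simpa only [map_mul, word_H] using this
  fin_cases i <;> fin_cases j <;> exact h _ (by simp [Gen.units]) _ (by simp [Gen.units])

theorem h_sq_mul_genUnit (i : Fin 2) : gen .h * gen .h * (genUnit i : MonoidM) = gen .h * gen .h := by
  have h : ∀ x ∈ Gen.units, gen .h * gen .h * word x = gen .h * gen .h := fun x hx => by
    have := word_eq (.inl (.inr ⟨x, hx, rfl⟩))
    simpa only [pow_two, map_mul, word_H] using this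
  fin_cases i <;> exact h _ (by simp [Gen.units])

theorem h_cube : gen .h * gen .h * gen .h = gen .h * gen .h := by
  have := word_eq (.inr rfl)
  simpa only [pow_succ, pow_zero, one_mul, map_mul, word_H] using this

/-- The inclusion of the free group in the units of `M`. -/
def freeUnits : FreeGroup (Fin 2) →* MonoidMˣ := FreeGroup.lift genUnit

/-- The induction principle for units in the image of the free group. -/
theorem freeUnits_induction {P : MonoidMˣ → Prop} (one : P 1) (gen : ∀ i, P (genUnit i))
    (inv : ∀ x, P x → P x⁻¹)
    (mul : ∀ x y, P x → P y → P (x * y)) (g : FreeGroup (Fin 2)) :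
    P (freeUnits g) := by
  induction g using FreeGroup.induction_on with
  | C1 => rwa [map_one]
  | of i => rw [freeUnits, FreeGroup.lift_apply_of]; exact gen i
  | inv_of i h => rw [map_inv]; exact inv _ h
  | mul x y hx hy => rw [map_mul]; exact mul _ _ hx hy

theorem freeUnits_mul_h (g : FreeGroup (Fin 2)) :
    (freeUnits g : MonoidM) * gen .h = gen .h * freeUnits g := by
  refine freeUnits_induction (P := fun u => (u : MonoidM) * gen .h = gen .h * u) ?_ genUnit_mul_h
    ?_ ?_ g
  · simp
  · intro x hx
    rw [Units.inv_mul_eq_iff_eq_mul, ← mul_assoc, hx, Units.mul_inv_cancel_right]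
  · intro x y hx hy
    rw [Units.val_mul, mul_assoc, hy, ← mul_assoc, hx, mul_assoc]

/-- Commutation behind `h` passes to products and inverses because units move past `h`; the
induction carries both facts together. Two applications, one per variable, give
`h_mul_freeUnits_mul`. -/
theorem h_mul_freeUnits_mul_of_genUnit (z : MonoidMˣ)
    (hz : ∀ i, gen .h * (genUnit i : MonoidM) * z = gen .h * (z : MonoidM) * genUnit i)
    (x : FreeGroup (Fin 2)) :
    gen .h * (freeUnits x : MonoidM) * z = gen .h * (z : MonoidM) * freeUnits x := by
  refine (freeUnits_induction (P := fun u => (u : MonoidM) * gen .h = gen .h * u ∧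
    gen .h * (u : MonoidM) * z = gen .h * (z : MonoidM) * u) ?_ (fun i => ⟨genUnit_mul_h i, hz i⟩)
    ?_ ?_ x).2
  · simp
  · rintro x ⟨hx, hxz⟩
    have hx' : ((x⁻¹ : MonoidMˣ) : MonoidM) * gen .h = gen .h * (x⁻¹ : MonoidMˣ) := by
      rw [Units.inv_mul_eq_iff_eq_mul, ← mul_assoc, hx, Units.mul_inv_cancel_right]
    refine ⟨hx', ?_⟩
    rw [Units.eq_mul_inv_iff_mul_eq, ← hx', mul_assoc, mul_assoc, ← mul_assoc _ _ (x : MonoidM),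
      ← hxz, ← hx, mul_assoc, Units.inv_mul_cancel_left]
  · rintro x y ⟨hx, hxz⟩ ⟨hy, hyz⟩
    refine ⟨by rw [Units.val_mul, mul_assoc, hy, ← mul_assoc, hx, mul_assoc], ?_⟩
    calc gen .h * ((x * y : MonoidMˣ) : MonoidM) * z
        = x * (gen .h * y * z) := by rw [Units.val_mul, ← mul_assoc, ← hx]; simp only [mul_assoc]
      _ = gen .h * x * z * y := by rw [hyz, ← hx]; simp only [mul_assoc]
      _ = gen .h * z * (x * y : MonoidMˣ) := by rw [hxz, Units.val_mul]; simp only [mul_assoc]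

theorem h_mul_freeUnits_mul (x y : FreeGroup (Fin 2)) :
    gen .h * (freeUnits x : MonoidM) * freeUnits y =
      gen .h * (freeUnits y : MonoidM) * freeUnits x :=
  h_mul_freeUnits_mul_of_genUnit _ (fun i =>
    (h_mul_freeUnits_mul_of_genUnit (genUnit i) (fun j => h_mul_genUnit_mul j i) y).symm) x

/-- The elements of the free group that fix `h`. -/
def fixator : Subgroup (FreeGroup (Fin 2)) where
  carrier := {g | gen .h * (freeUnits g : MonoidM) = gen .h}
  one_mem' := by simp
  mul_mem' := by
    intro x y hx hy
    simp only [Set.mem_ofPred_eq] at hx hy ⊢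
    rw [map_mul, Units.val_mul, ← mul_assoc, hx, hy]
  inv_mem' := by
    intro x hx
    simp only [Set.mem_ofPred_eq] at hx ⊢
    rw [map_inv, Units.mul_inv_eq_iff_eq_mul, hx]

/-- This is what makes the layer of `h` a quotient of the abelianization. -/
theorem commutator_le_fixator : commutator (FreeGroup (Fin 2)) ≤ fixator := by
  rw [commutator_def, Subgroup.commutator_le]
  intro x _ y _
  change gen .h * (freeUnits (x * y * x⁻¹ * y⁻¹) : MonoidM) = gen .h
  simp only [map_mul, map_inv, Units.val_mul, ← mul_assoc]
  rw [Units.mul_inv_eq_iff_eq_mul, Units.mul_inv_eq_iff_eq_mul, h_mul_freeUnits_mul]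

theorem h_mul_freeUnits_congr {x y : FreeGroup (Fin 2)} (h : abHom x = abHom y) :
    gen .h * (freeUnits x : MonoidM) = gen .h * freeUnits y := by
  have hxy : x * y⁻¹ ∈ commutator (FreeGroup (Fin 2)) := by
    rw [← Abelianization.ker_of, MonoidHom.mem_ker, map_mul, map_inv, h, mul_inv_cancel]
  have := commutator_le_fixator hxy
  change gen .h * (freeUnits (x * y⁻¹) : MonoidM) = gen .h at this
  rwa [map_mul, map_inv, Units.val_mul, ← mul_assoc, Units.mul_inv_eq_iff_eq_mul] at this

theorem h_sq_mul_freeUnits (g : FreeGroup (Fin 2)) :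
    gen .h * gen .h * (freeUnits g : MonoidM) = gen .h * gen .h := by
  refine freeUnits_induction (P := fun u => gen .h * gen .h * (u : MonoidM) = gen .h * gen .h) ?_
    h_sq_mul_genUnit ?_ ?_ g
  · simp
  · intro x hx
    rw [Units.mul_inv_eq_iff_eq_mul, hx]
  · intro x y hx hy
    rw [Units.val_mul, ← mul_assoc, hx, hy]

/-- The element of `M` given by an element of the model. -/
noncomputable def ofModel : ModelM → MonoidM
  | unit g => freeUnits g
  | mid q => gen .h * freeUnits (Function.surjInv abHom_surjective q)
  | zero => gen .h * gen .h

/-- The arbitrary preimage chosen in `ofModel` does not matter. -/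
theorem ofModel_mid (g : FreeGroup (Fin 2)) :
    ofModel (mid (abHom g)) = gen .h * freeUnits g :=
  h_mul_freeUnits_congr (Function.surjInv_eq abHom_surjective _)

theorem ofModel_unit_mul (g : FreeGroup (Fin 2)) (t : ModelM) :
    ofModel (unit g * t) = freeUnits g * ofModel t := by
  cases t with
  | unit g' => simp [ofModel]
  | mid q =>
    obtain ⟨g', rfl⟩ := abHom_surjective q
    rw [unit_mul_mid, ← map_mul, ofModel_mid, ofModel_mid, ← mul_assoc, freeUnits_mul_h, map_mul,
      Units.val_mul, mul_assoc]
  | zero =>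
    rw [LayeredMonoid.mul_zero, ofModel, ← mul_assoc, freeUnits_mul_h, mul_assoc, freeUnits_mul_h,
      ← mul_assoc, h_sq_mul_freeUnits]

theorem ofModel_mid_one_mul (t : ModelM) : ofModel (mid 1 * t) = gen .h * ofModel t := by
  cases t with
  | unit g => rw [mid_mul_unit, one_mul, ofModel_mid, ofModel]
  | mid q =>
    obtain ⟨g, rfl⟩ := abHom_surjective q
    rw [mid_mul_mid, ofModel_mid, ofModel, ← mul_assoc, h_sq_mul_freeUnits]
  | zero => rw [LayeredMonoid.mul_zero, ofModel, ← mul_assoc, h_cube]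

/-- Equivariance under generators is enough to prove `ofModel_toModel` by induction on words,
without first showing that `ofModel` is multiplicative. -/
theorem ofModel_genModel_mul (x : Gen) (t : ModelM) :
    ofModel (genModel x * t) = gen x * ofModel t := by
  cases x with
  | a => exact (ofModel_unit_mul _ t).trans (by rw [freeUnits, FreeGroup.lift_apply_of]; rfl)
  | a' =>
    exact (ofModel_unit_mul _ t).trans (by rw [map_inv, freeUnits, FreeGroup.lift_apply_of]; rfl)
  | b => exact (ofModel_unit_mul _ t).trans (by rw [freeUnits, FreeGroup.lift_apply_of]; rfl)
  | b' =>
    exact (ofModel_unit_mul _ t).trans (by rw [map_inv, freeUnits, FreeGroup.lift_apply_of]; rfl)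
  | h => exact ofModel_mid_one_mul t

theorem ofModel_toModel (x : MonoidM) : ofModel (toModel x) = x := by
  obtain ⟨w, rfl⟩ := PresentedMonoid.surjective_mk x
  induction w using FreeMonoid.inductionOn' with
  | one => simp [one_def, ofModel]
  | of_mul p w ih =>
    rw [map_mul, map_mul]
    exact (ofModel_genModel_mul p _).trans (congrArg _ ih)

theorem toModel_ofModel (t : ModelM) : toModel (ofModel t) = t := by
  have hu : ∀ g, toModel (freeUnits g) = unit g := by
    have : toModel.comp ((Units.coeHom MonoidM).comp freeUnits) = unitHom abHom := by
      ext i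
      fin_cases i <;> simp [freeUnits] <;> rfl
    exact DFunLike.congr_fun this
  cases t with
  | unit g => exact hu g
  | mid q =>
    obtain ⟨g, rfl⟩ := abHom_surjective q
    rw [ofModel_mid, map_mul, hu, toModel_gen, genModel, mid_mul_unit, one_mul]
  | zero => rw [ofModel, map_mul, toModel_gen, genModel, mid_mul_mid]

/-- The monoid `M` is isomorphic to its model. -/
noncomputable def modelEquiv : MonoidM ≃* ModelM where
  toFun := toModel
  invFun := ofModel
  left_inv := ofModel_toModel
  right_inv := toModel_ofModel
  map_mul' := map_mul toModel

end MonoidM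

/-- The free abelian group of rank two as the abelianization of the free group. -/
def abelianizationEquiv :
    Abelianization (FreeGroup (Fin 2)) ≃* Multiplicative (FreeAbelianGroup (Fin 2)) :=
  -- `FreeAbelianGroup α` is by definition `Additive (Abelianization (FreeGroup α))`.
  (MulEquiv.toMultiplicative_toAdditive (G := Abelianization (FreeGroup (Fin 2)))).symm

open LayeredMonoid MonoidM in
theorem hasFiniteCompleteRewriting_schutzenbergerGroup (x : MonoidM) :
    HasFiniteCompleteRewriting (SchutzenbergerGroup x) := by
  cases hx : modelEquiv x with
  | unit g =>
    obtain ⟨e⟩ := schutzenbergerGroup_unit modelEquiv x abHom_surjective hx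
    exact (hasFiniteCompleteRewriting_freeGroup (Fin 2)).of_mulEquiv e.symm
  | mid q =>
    obtain ⟨e⟩ := schutzenbergerGroup_mid modelEquiv x abHom_surjective hx
    exact hasFiniteCompleteRewriting_freeAbelianGroup.of_mulEquiv
      (e.trans abelianizationEquiv).symm
  | zero =>
    obtain ⟨e⟩ := schutzenbergerGroup_zero modelEquiv x abHom_surjective hx
    exact hasFiniteCompleteRewriting_unit.of_mulEquiv e.symm

theorem hClass_eq_preimage {S : Type u} {T : Type v} [Monoid S] [Monoid T] (e : S ≃* T) (x : S) :
    hClass x = e ⁻¹' hClass (e x) := by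
  rw [hClass_map, e.injective.preimage_image]

namespace MonoidM

open LayeredMonoid

theorem setOf_isHClass : {H : Set MonoidM | IsHClass H} =
    {modelEquiv ⁻¹' {zero}, modelEquiv ⁻¹' Set.range mid, modelEquiv ⁻¹' Set.range unit} := by
  ext H
  constructor
  · rintro ⟨x, rfl⟩
    rw [hClass_eq_preimage modelEquiv]
    cases hx : modelEquiv x with
    | unit g => exact .inr (.inr (congrArg _ (hClass_unit g)))
    | mid q => exact .inr (.inl (congrArg _ (hClass_mid abHom_surjective q)))
    | zero => exact .inl (congrArg _ hClass_zero)
  · rintro (rfl | rfl | rfl)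
    · exact ⟨modelEquiv.symm zero, by
        rw [hClass_eq_preimage modelEquiv, modelEquiv.apply_symm_apply, hClass_zero]⟩
    · exact ⟨modelEquiv.symm (mid 1), by
        rw [hClass_eq_preimage modelEquiv, modelEquiv.apply_symm_apply,
          hClass_mid abHom_surjective]⟩
    · exact ⟨modelEquiv.symm (unit 1), by
        rw [hClass_eq_preimage modelEquiv, modelEquiv.apply_symm_apply, hClass_unit]⟩

/-- The `H`-classes of `M` and their Schützenberger groups. -/
theorem exists_hClasses : ∃ H₁ H₂ H₃ : Set MonoidM,
    H₁ ≠ H₂ ∧ H₁ ≠ H₃ ∧ H₂ ≠ H₃ ∧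
    {H : Set MonoidM | IsHClass H} = {H₁, H₂, H₃} ∧
    (∀ x ∈ H₁, Nonempty (SchutzenbergerGroup x ≃* Unit)) ∧
    (∀ x ∈ H₂, Nonempty
      (SchutzenbergerGroup x ≃* Multiplicative (FreeAbelianGroup (Fin 2)))) ∧
    (∀ x ∈ H₃, Nonempty (SchutzenbergerGroup x ≃* FreeGroup (Fin 2))) := by
  have hinj : Function.Injective (Set.preimage modelEquiv) := modelEquiv.surjective.preimage_injective
  refine ⟨_, _, _, ?_, ?_, ?_, setOf_isHClass, ?_, ?_, ?_⟩
  · refine hinj.ne fun h => ?_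
    obtain ⟨q, hq⟩ := h.le (Set.mem_singleton zero)
    cases hq
  · refine hinj.ne fun h => ?_
    obtain ⟨q, hq⟩ := h.le (Set.mem_singleton zero)
    cases hq
  · refine hinj.ne fun h => ?_
    obtain ⟨q, hq⟩ := h.le (Set.mem_range_self 1)
    cases hq
  · intro x hx
    exact schutzenbergerGroup_zero modelEquiv x abHom_surjective hx
  · rintro x ⟨q, hq⟩
    obtain ⟨e⟩ := schutzenbergerGroup_mid modelEquiv x abHom_surjective hq.symm
    exact ⟨e.trans abelianizationEquiv⟩
  · rintro x ⟨g, hg⟩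
    exact schutzenbergerGroup_unit modelEquiv x abHom_surjective hg.symm

end MonoidM

/-! ### Labelled derivation graphs -/

namespace DerivationGraph

variable {A : Type u} {R : Set (FreeMonoid A × FreeMonoid A)} {K : Type v} [Group K]

/-- The label of a signed rule. -/
def signedLabel (l : R → K) (r : R) (ε : Bool) : K := if ε then l r else (l r)⁻¹

theorem signedLabel_not (l : R → K) (r : R) (ε : Bool) :
    signedLabel l r (!ε) = (signedLabel l r ε)⁻¹ := by
  cases ε <;> simp [signedLabel]

/-- The label of an edge, which depends on its signed rule only. -/
def edgeLabel (l : R → K) {x y : DerivationGraph R} (e : x ⟶ y) : K :=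
  signedLabel l (Edge.rule e) (Edge.sign e)

/-- The label of a path. -/
def pathLabel (l : R → K) {x : DerivationGraph R} :
    ∀ {y : DerivationGraph R}, Quiver.Path x y → K
  | _, .nil => 1
  | _, .cons p e => pathLabel l p * edgeLabel l e

variable (l : R → K) {x y z : DerivationGraph R}

theorem pathLabel_toPath (e : x ⟶ y) : pathLabel l e.toPath = edgeLabel l e := one_mul _

theorem pathLabel_comp (p : Quiver.Path x y) (q : Quiver.Path y z) :
    pathLabel l (p.comp q) = pathLabel l p * pathLabel l q := by
  induction q with
  | nil => exact (mul_one _).symm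
  | cons q e ih => rw [Quiver.Path.comp_cons, pathLabel, pathLabel, ih, mul_assoc]

theorem pathLabel_reverse (p : Quiver.Path x y) :
    pathLabel l p.reverse = (pathLabel l p)⁻¹ := by
  induction p with
  | nil => exact inv_one.symm
  | cons p e ih =>
    rw [Quiver.Path.reverse, pathLabel_comp, ih, pathLabel_toPath, pathLabel, mul_inv_rev]
    exact congrArg (· * _) (signedLabel_not l (Edge.rule e) (Edge.sign e))

/-- Labels ignore the context of a rule, so compatibility with the two-sided action is automatic. -/
theorem pathLabel_mapPath_act (w z : DerivationGraph R) (p : Quiver.Path x y) :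
    pathLabel l ((act w z).mapPath p) = pathLabel l p := by
  induction p with
  | nil => rfl
  | cons p e ih =>
    rw [Prefunctor.mapPath_cons, pathLabel, pathLabel, ih]
    rfl

theorem exists_pathLabel_mul_right (p : Quiver.Path x y) (w : DerivationGraph R) :
    ∃ q : Quiver.Path (x * w) (y * w), pathLabel l q = pathLabel l p := by
  have h : ∃ q : Quiver.Path (1 * x * w) (1 * y * w), pathLabel l q = pathLabel l p :=
    ⟨(act 1 w).mapPath p, pathLabel_mapPath_act l 1 w p⟩
  rwa [one_mul, one_mul] at h

theorem exists_pathLabel_mul_left (p : Quiver.Path x y) (w : DerivationGraph R) :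
    ∃ q : Quiver.Path (w * x) (w * y), pathLabel l q = pathLabel l p := by
  have h : ∃ q : Quiver.Path (w * x * 1) (w * y * 1), pathLabel l q = pathLabel l p :=
    ⟨(act w 1).mapPath p, pathLabel_mapPath_act l w 1 p⟩
  rwa [mul_one, mul_one] at h

/-- The two ways around the square spanned by a path to a left multiple and a path to a right
multiple of a word. -/
theorem exists_pathLabel_square {u v w : DerivationGraph R} (p : Quiver.Path w (u * w))
    (q : Quiver.Path w (w * v)) : ∃ p' q' : Quiver.Path w (u * w * v),
      pathLabel l p' = pathLabel l p * pathLabel l q ∧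
      pathLabel l q' = pathLabel l q * pathLabel l p := by
  obtain ⟨p', hp⟩ := exists_pathLabel_mul_right l p v
  have h := exists_pathLabel_mul_left l q u
  rw [← mul_assoc] at h
  obtain ⟨q', hq⟩ := h
  exact ⟨p.comp q', q.comp p', by rw [pathLabel_comp, hq], by rw [pathLabel_comp, hp]⟩

theorem nonempty_path_mul_right (h : Nonempty (Quiver.Path x y)) (w : DerivationGraph R) :
    Nonempty (Quiver.Path (x * w) (y * w)) := by
  obtain ⟨p⟩ := h
  have p' : Quiver.Path (1 * x * w) (1 * y * w) := (act 1 w).mapPath p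
  rw [one_mul, one_mul] at p'
  exact ⟨p'⟩

theorem nonempty_path_mul_left (h : Nonempty (Quiver.Path x y)) (w : DerivationGraph R) :
    Nonempty (Quiver.Path (w * x) (w * y)) := by
  obtain ⟨p⟩ := h
  have p' : Quiver.Path (w * x * 1) (w * y * 1) := (act w 1).mapPath p
  rw [mul_one, mul_one] at p'
  exact ⟨p'⟩

theorem reachable_of_mk_eq {x y : FreeMonoid A}
    (h : PresentedMonoid.mk (fun x y => (x, y) ∈ R) x = PresentedMonoid.mk _ y) :
    Nonempty (Quiver.Path (V := DerivationGraph R) x y) := by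
  have hxy := PresentedMonoid.mk_eq_mk_iff.1 h
  clear h
  induction hxy with
  | of x y h =>
    exact ⟨Quiver.Hom.toPath (V := DerivationGraph R)
      (Edge.mk (R := R) 1 ⟨(x, y), h⟩ true 1 (by simp [side]; rfl) (by simp [side]; rfl))⟩
  | refl x => exact ⟨.nil⟩
  | symm _ ih => exact ih.map Quiver.Path.reverse
  | trans _ _ ih ih' =>
    obtain ⟨p⟩ := ih
    obtain ⟨q⟩ := ih'
    exact ⟨p.comp q⟩
  | mul _ _ ih ih' =>
    obtain ⟨p⟩ := nonempty_path_mul_right ih _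
    obtain ⟨q⟩ := nonempty_path_mul_left ih' _
    exact ⟨p.comp q⟩

end DerivationGraph

/-! ### The monoid of two-sided translates -/

/-- The monoid `G ⊔ G × G ⊔ {0}`, where `pair x y` stands for `x h y⁻¹`. -/
inductive PairMonoid (G : Type u) : Type u
  | unit (g : G)
  | pair (x y : G)
  | zero

namespace PairMonoid

variable {G : Type u} [Group G]

/-- Multiplication of two-sided translates. -/
def mul : PairMonoid G → PairMonoid G → PairMonoid G
  | unit g, unit g' => unit (g * g')
  | unit g, pair x y => pair (g * x) y
  | pair x y, unit g => pair x (g⁻¹ * y)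
  | pair _ _, pair _ _ => zero
  | zero, _ => zero
  | _, zero => zero

instance : Mul (PairMonoid G) := ⟨mul⟩

instance : One (PairMonoid G) := ⟨unit 1⟩

theorem one_def : (1 : PairMonoid G) = unit 1 := rfl

@[simp] theorem unit_mul_unit (g g' : G) : (unit g * unit g' : PairMonoid G) = unit (g * g') := rfl

@[simp] theorem unit_mul_pair (g x y : G) : (unit g * pair x y : PairMonoid G) = pair (g * x) y :=
  rfl

@[simp] theorem pair_mul_unit (g x y : G) : (pair x y * unit g : PairMonoid G) = pair x (g⁻¹ * y) :=
  rfl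

@[simp] theorem pair_mul_pair (x y x' y' : G) : (pair x y * pair x' y' : PairMonoid G) = zero := rfl

@[simp] theorem zero_mul (x : PairMonoid G) : zero * x = zero := rfl

@[simp] theorem mul_zero (x : PairMonoid G) : x * zero = zero := by
  cases x <;> rfl

instance : Monoid (PairMonoid G) where
  mul_assoc x y z := by
    cases x <;> cases y <;> cases z <;> simp [mul_assoc]
  one_mul x := by
    cases x <;> simp [one_def]
  mul_one x := by
    cases x <;> simp [one_def]

variable {Q : Type v} [CommGroup Q] (f : G →* Q)

/-- The projection to the layered monoid. -/
def toLayered : PairMonoid G →* LayeredMonoid f where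
  toFun
    | unit g => .unit g
    | pair x y => .mid (f x * (f y)⁻¹)
    | zero => .zero
  map_one' := rfl
  map_mul' x y := by
    cases x <;> cases y <;> simp [mul_assoc, mul_comm, mul_left_comm]

@[simp] theorem toLayered_unit (g : G) : toLayered f (unit g) = .unit g := rfl

@[simp] theorem toLayered_pair (x y : G) : toLayered f (pair x y) = .mid (f x * (f y)⁻¹) := rfl

@[simp] theorem toLayered_zero : toLayered f (zero : PairMonoid G) = .zero := rfl

theorem toLayered_eq_unit {t : PairMonoid G} {g : G} (h : toLayered f t = .unit g) :
    t = unit g := by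
  cases t <;> simp at h ⊢
  exact h

theorem toLayered_eq_mid {t : PairMonoid G} {q : Q} (h : toLayered f t = .mid q) :
    ∃ x y, t = pair x y ∧ f x * (f y)⁻¹ = q := by
  cases t <;> simp at h ⊢
  exact h

theorem toLayered_surjective (hf : Function.Surjective f) :
    Function.Surjective (toLayered f) := by
  rintro (g | q | _)
  · exact ⟨unit g, rfl⟩
  · obtain ⟨g, rfl⟩ := hf q
    exact ⟨pair g 1, by simp⟩
  · exact ⟨zero, rfl⟩

end PairMonoid

/-! ### A central extension -/

/-- The group of the matrices `!![1, x, z; 0, t, y; 0, 0, 1]` over `ℚ`. -/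
@[ext]
structure AffineHeisenberg : Type where
  t : ℚˣ
  x : ℚ
  y : ℚ
  z : ℚ

namespace AffineHeisenberg

instance : Mul AffineHeisenberg :=
  ⟨fun m n => ⟨m.t * n.t, n.x + m.x * n.t, m.t * n.y + m.y, n.z + m.x * n.y + m.z⟩⟩

instance : One AffineHeisenberg := ⟨⟨1, 0, 0, 0⟩⟩

instance : Inv AffineHeisenberg :=
  ⟨fun m => ⟨m.t⁻¹, -m.x * (m.t⁻¹ : ℚˣ), -(m.t⁻¹ : ℚˣ) * m.y, m.x * (m.t⁻¹ : ℚˣ) * m.y - m.z⟩⟩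

variable (m n : AffineHeisenberg)

@[simp] theorem mul_t : (m * n).t = m.t * n.t := rfl
@[simp] theorem mul_x : (m * n).x = n.x + m.x * n.t := rfl
@[simp] theorem mul_y : (m * n).y = m.t * n.y + m.y := rfl
@[simp] theorem mul_z : (m * n).z = n.z + m.x * n.y + m.z := rfl
@[simp] theorem one_t : (1 : AffineHeisenberg).t = 1 := rfl
@[simp] theorem one_x : (1 : AffineHeisenberg).x = 0 := rfl
@[simp] theorem one_y : (1 : AffineHeisenberg).y = 0 := rfl
@[simp] theorem one_z : (1 : AffineHeisenberg).z = 0 := rfl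
@[simp] theorem inv_t : (m⁻¹).t = m.t⁻¹ := rfl
@[simp] theorem inv_x : (m⁻¹).x = -m.x * (m.t⁻¹ : ℚˣ) := rfl
@[simp] theorem inv_y : (m⁻¹).y = -(m.t⁻¹ : ℚˣ) * m.y := rfl
@[simp] theorem inv_z : (m⁻¹).z = m.x * (m.t⁻¹ : ℚˣ) * m.y - m.z := rfl

instance : Group AffineHeisenberg :=
  Group.ofLeftAxioms
    (fun a b c => by
      ext <;> simp <;> ring)
    (fun a => by ext <;> simp)
    (fun a => by
      ext <;> simp
      ring)

/-- The upper left block. -/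
def upper : AffineHeisenberg →* AffineHeisenberg where
  toFun m := ⟨m.t, m.x, 0, 0⟩
  map_one' := rfl
  map_mul' m n := by ext <;> simp

/-- The lower right block. -/
def lower : AffineHeisenberg →* AffineHeisenberg where
  toFun m := ⟨m.t, 0, m.y, 0⟩
  map_one' := rfl
  map_mul' m n := by ext <;> simp

/-- The determinant. -/
def det : AffineHeisenberg →* ℚˣ where
  toFun m := m.t
  map_one' := rfl
  map_mul' _ _ := rfl

/-- Equality up to the central subgroup given by `D`. -/
def CongrMod (D : AddSubgroup ℚ) (m n : AffineHeisenberg) : Prop :=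
  m.t = n.t ∧ m.x = n.x ∧ m.y = n.y ∧ m.z - n.z ∈ D

variable {D : AddSubgroup ℚ}

theorem CongrMod.refl (m : AffineHeisenberg) : CongrMod D m m :=
  ⟨rfl, rfl, rfl, by rw [sub_self]; exact D.zero_mem⟩

theorem CongrMod.symm {m n : AffineHeisenberg} (h : CongrMod D m n) : CongrMod D n m :=
  ⟨h.1.symm, h.2.1.symm, h.2.2.1.symm, by rw [← neg_sub]; exact D.neg_mem h.2.2.2⟩

theorem CongrMod.trans {m n k : AffineHeisenberg} (h : CongrMod D m n) (h' : CongrMod D n k) :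
    CongrMod D m k :=
  ⟨h.1.trans h'.1, h.2.1.trans h'.2.1, h.2.2.1.trans h'.2.2.1, by
    rw [← sub_add_sub_cancel m.z n.z k.z]; exact D.add_mem h.2.2.2 h'.2.2.2⟩

/-- The corner entry is central: the cross term `m.x * n.y` is the same on both sides, so the
discrepancies in `z` simply add. -/
theorem CongrMod.mul {m m' n n' : AffineHeisenberg} (h : CongrMod D m m') (h' : CongrMod D n n') :
    CongrMod D (m * n) (m' * n') := by
  obtain ⟨h₁, h₂, h₃, h₄⟩ := h
  obtain ⟨h₁', h₂', h₃', h₄'⟩ := h'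
  refine ⟨by simp [*], by simp [*], by simp [*], ?_⟩
  have : (m * n).z - (m' * n').z = (n.z - n'.z) + (m.z - m'.z) := by
    simp [h₂, h₃']
    ring
  rw [this]
  exact D.add_mem h₄' h₄

/-- The representation of the free group by upper left blocks. -/
def rhoUpper : FreeGroup (Fin 2) →* AffineHeisenberg :=
  FreeGroup.lift fun i => if i = 0 then ⟨Units.mk0 2 two_ne_zero, 0, 0, 0⟩ else ⟨1, 1, 0, 0⟩

/-- The representation of the free group by lower right blocks. -/
def rhoLower : FreeGroup (Fin 2) →* AffineHeisenberg :=
  FreeGroup.lift fun i => if i = 0 then ⟨Units.mk0 2 two_ne_zero, 0, 0, 0⟩ else ⟨1, 0, 1, 0⟩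

theorem upper_rhoUpper (g : FreeGroup (Fin 2)) : upper (rhoUpper g) = rhoUpper g := by
  have : upper.comp rhoUpper = rhoUpper := by
    refine FreeGroup.ext_hom _ _ fun i => ?_
    fin_cases i <;> simp [rhoUpper, upper]
  exact DFunLike.congr_fun this g

theorem lower_rhoLower (g : FreeGroup (Fin 2)) : lower (rhoLower g) = rhoLower g := by
  have : lower.comp rhoLower = rhoLower := by
    refine FreeGroup.ext_hom _ _ fun i => ?_
    fin_cases i <;> simp [rhoLower, lower]
  exact DFunLike.congr_fun this g

/-- Both diagonal characters send a to 2 and b to 1, and a character into `ℚˣ` factors through the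
abelianization. -/
theorem rho_t_eq {c d : FreeGroup (Fin 2)} (h : abHom c = abHom d) :
    (rhoUpper c).t = (rhoLower d).t := by
  have h₁ : det.comp rhoUpper = det.comp rhoLower := by
    ext i
    fin_cases i <;> simp [rhoLower, rhoUpper, det]
  have h₂ := DFunLike.congr_fun h₁ d
  have h₃ := congrArg (Abelianization.lift (det.comp rhoUpper)) h
  rw [abHom, Abelianization.lift_apply_of, Abelianization.lift_apply_of] at h₃
  exact h₃.trans h₂

/-- `m` lifts the pair `(c, d)`. -/
def IsLift (m : AffineHeisenberg) (c d : FreeGroup (Fin 2)) : Prop :=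
  upper m = rhoUpper c ∧ lower m = rhoLower d

theorem exists_isLift {c d : FreeGroup (Fin 2)} (h : abHom c = abHom d) :
    ∃ m, IsLift m c d := by
  refine ⟨⟨(rhoUpper c).t, (rhoUpper c).x, (rhoLower d).y, 0⟩, ?_, ?_⟩
  · exact (upper_rhoUpper c)
  · rw [rho_t_eq h]
    exact (lower_rhoLower d)

theorem IsLift.one : IsLift 1 1 1 := ⟨by simp, by simp⟩

theorem IsLift.mul {m m' : AffineHeisenberg} {c d c' d' : FreeGroup (Fin 2)} (h : IsLift m c d)
    (h' : IsLift m' c' d') : IsLift (m * m') (c * c') (d * d') :=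
  ⟨by rw [map_mul, map_mul, h.1, h'.1], by rw [map_mul, map_mul, h.2, h'.2]⟩

theorem IsLift.inv {m : AffineHeisenberg} {c d : FreeGroup (Fin 2)} (h : IsLift m c d) :
    IsLift m⁻¹ c⁻¹ d⁻¹ :=
  ⟨by rw [map_inv, map_inv, h.1], by rw [map_inv, map_inv, h.2]⟩

/-- The two blocks determine everything except the corner. -/
theorem IsLift.congr {m m' : AffineHeisenberg} {c d : FreeGroup (Fin 2)} (h : IsLift m c d)
    (h' : IsLift m' c d) : m.t = m'.t ∧ m.x = m'.x ∧ m.y = m'.y := by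
  have h₁ := h.1.trans h'.1.symm
  have h₂ := h.2.trans h'.2.symm
  have ht := congrArg AffineHeisenberg.t h₁
  have hx := congrArg AffineHeisenberg.x h₁
  have hy := congrArg AffineHeisenberg.y h₂
  exact ⟨ht, hx, hy⟩

/-- The commutator `aⁿ b a⁻ⁿ b⁻¹`. -/
def comm (n : ℕ) : FreeGroup (Fin 2) :=
  FreeGroup.of 0 ^ n * FreeGroup.of 1 * (FreeGroup.of 0 ^ n)⁻¹ * (FreeGroup.of 1)⁻¹

theorem abHom_comm (n : ℕ) : abHom (comm n) = 1 := by
  simp only [comm, map_mul, map_inv]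
  rw [mul_comm (abHom _) (abHom (FreeGroup.of 1)), mul_inv_cancel_right, mul_inv_cancel]

theorem mk_pow (s : ℚˣ) (n : ℕ) :
    (⟨s, 0, 0, 0⟩ : AffineHeisenberg) ^ n = ⟨s ^ n, 0, 0, 0⟩ := by
  induction n with
  | zero => rw [pow_zero, pow_zero]; rfl
  | succ n ih => rw [pow_succ, ih]; ext <;> simp [pow_succ]

theorem rhoUpper_comm (n : ℕ) : rhoUpper (comm n) = ⟨1, (1 / 2) ^ n - 1, 0, 0⟩ := by
  simp only [comm, map_mul, map_inv, map_pow, rhoUpper, FreeGroup.lift_apply_of, if_pos,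
    mk_pow]
  ext <;> simp
  ring

theorem rhoLower_comm_one : rhoLower (comm 1) = ⟨1, 0, 1, 0⟩ := by
  simp only [comm, map_mul, map_inv, map_pow, rhoLower, FreeGroup.lift_apply_of, if_pos,
    mk_pow]
  ext <;> simp
  norm_num

/-- The difference is `m.x * k.y - k.x * m.y`, whatever the corners of `m` and `k`, so the choice of
lifts does not affect it. -/
theorem IsLift.mul_z_sub_mul_z {m k : AffineHeisenberg} {n : ℕ} (hm : IsLift m (comm n) 1)
    (hk : IsLift k 1 (comm 1)) : (m * k).z - (k * m).z = (1 / 2) ^ n - 1 := by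
  have hmx : m.x = (1 / 2) ^ n - 1 := by
    have := congrArg AffineHeisenberg.x hm.1
    rwa [rhoUpper_comm] at this
  have hkx : k.x = 0 := by
    have := congrArg AffineHeisenberg.x hk.1
    rwa [map_one] at this
  have hky : k.y = 1 := by
    have := congrArg AffineHeisenberg.y hk.2
    rwa [rhoLower_comm_one] at this
  rw [mul_z, mul_z, hmx, hkx, hky]
  ring

end AffineHeisenberg

/-! ### Finitely generated subgroups of ℚ -/

theorem exists_common_denominator {s : Set ℚ} (hs : s.Finite) :
    ∃ N : ℕ, 0 < N ∧ ∀ d ∈ AddSubgroup.closure s, ∃ k : ℤ, d * N = k := by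
  have h : ∃ N : ℕ, 0 < N ∧ ∀ d ∈ s, ∃ k : ℤ, d * N = k := by
    induction s, hs using Set.Finite.induction_on with
    | empty => exact ⟨1, one_pos, fun d hd => hd.elim⟩
    | @insert a s _ _ ih =>
      obtain ⟨N, hN, h⟩ := ih
      refine ⟨a.den * N, Nat.mul_pos a.den_pos hN, ?_⟩
      rintro d (rfl | hd)
      · refine ⟨d.num * N, ?_⟩
        push_cast
        rw [← mul_assoc, Rat.mul_den_eq_num]
      · obtain ⟨k, hk⟩ := h d hd
        refine ⟨k * a.den, ?_⟩
        push_cast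
        rw [← hk]
        ring
  obtain ⟨N, hN, h⟩ := h
  refine ⟨N, hN, fun d hd => ?_⟩
  induction hd using AddSubgroup.closure_induction with
  | mem x hx => exact h x hx
  | zero => exact ⟨0, by simp⟩
  | add x y _ _ hx hy =>
    obtain ⟨i, hi⟩ := hx
    obtain ⟨j, hj⟩ := hy
    exact ⟨i + j, by push_cast; rw [add_mul, hi, hj]⟩
  | neg x _ hx =>
    obtain ⟨i, hi⟩ := hx
    exact ⟨-i, by push_cast; rw [neg_mul, hi]⟩

theorem exists_pow_sub_one_notMem_closure {s : Set ℚ} (hs : s.Finite) :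
    ∃ n : ℕ, (1 / 2 : ℚ) ^ n - 1 ∉ AddSubgroup.closure s := by
  obtain ⟨N, hN, h⟩ := exists_common_denominator hs
  -- The common denominator serves as exponent: `N / 2 ^ N` would be an integer strictly between 0
  -- and 1.
  refine ⟨N, fun hmem => ?_⟩
  obtain ⟨k, hk⟩ := h _ hmem
  have h₁ : (N : ℚ) * (1 / 2) ^ N = (k + N : ℤ) := by
    push_cast
    rw [← hk]
    ring
  have hlt : (N : ℚ) < 2 ^ N := by exact_mod_cast Nat.lt_two_pow_self
  have h₂ : (N : ℚ) * (1 / 2) ^ N < 1 := by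
    rw [one_div, inv_pow, ← div_eq_mul_inv, div_lt_one (by positivity)]
    exact hlt
  have h₃ : 0 < (N : ℚ) * (1 / 2) ^ N := by positivity
  rw [h₁] at h₂ h₃
  have h₂' : k + N < 1 := by exact_mod_cast h₂
  have h₃' : 0 < k + N := by exact_mod_cast h₃
  omega

/-! ### The monoid `M` does not have finite derivation type -/

open DerivationGraph AffineHeisenberg

/-- A labelling of the rules of a presentation that is trivial on rules between units and lifts the
translation between the sides of the other nonzero rules. -/
structure IsLiftLabelling {A : Type u} {R : Set (FreeMonoid A × FreeMonoid A)}
    (Φ : FreeMonoid A →* PairMonoid (FreeGroup (Fin 2))) (l : R → AffineHeisenberg) : Prop where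
  side_eq : ∀ r : R, PairMonoid.toLayered abHom (Φ r.1.1) = PairMonoid.toLayered abHom (Φ r.1.2)
  unit : ∀ (r : R) (g : FreeGroup (Fin 2)), Φ r.1.1 = .unit g → l r = 1
  pair : ∀ (r : R) (x y x' y' : FreeGroup (Fin 2)), Φ r.1.1 = .pair x y → Φ r.1.2 = .pair x' y' →
    IsLift (l r) (x⁻¹ * x') (y⁻¹ * y')

theorem exists_isLiftLabelling {A : Type u} {R : Set (FreeMonoid A × FreeMonoid A)}
    (Φ : FreeMonoid A →* PairMonoid (FreeGroup (Fin 2)))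
    (h : ∀ r : R, PairMonoid.toLayered abHom (Φ r.1.1) = PairMonoid.toLayered abHom (Φ r.1.2)) :
    ∃ l : R → AffineHeisenberg, IsLiftLabelling Φ l := by
  have hex : ∀ r : R, ∃ m : AffineHeisenberg, (∀ g, Φ r.1.1 = .unit g → m = 1) ∧
      ∀ x y x' y', Φ r.1.1 = .pair x y → Φ r.1.2 = .pair x' y' →
        IsLift m (x⁻¹ * x') (y⁻¹ * y') := by
    intro r
    have hr := h r
    cases h₁ : Φ r.1.1 with
    | unit g => exact ⟨1, fun _ _ => rfl, by simp⟩
    | zero => exact ⟨1, by simp, by simp⟩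
    | pair x y =>
      rw [h₁, PairMonoid.toLayered_pair] at hr
      obtain ⟨x', y', h₂, h₃⟩ := PairMonoid.toLayered_eq_mid abHom hr.symm
      obtain ⟨m, hm⟩ := exists_isLift (c := x⁻¹ * x') (d := y⁻¹ * y') (by
        rw [map_mul, map_mul, map_inv, map_inv]
        rw [mul_inv_eq_iff_eq_mul] at h₃
        rw [h₃]
        simp only [mul_assoc, inv_mul_cancel_left])
      refine ⟨m, by simp, ?_⟩
      rintro _ _ x'' y'' h h'
      cases h
      rw [h₂] at h'
      cases h'
      exact hm
  choose l hl hl' using hex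
  exact ⟨l, h, hl, hl'⟩

namespace IsLiftLabelling

variable {A : Type u} {R : Set (FreeMonoid A × FreeMonoid A)}
  {Φ : FreeMonoid A →* PairMonoid (FreeGroup (Fin 2))} {l : R → AffineHeisenberg}

theorem side_not_eq_unit (hl : IsLiftLabelling Φ l) {r : R} {ε : Bool} {g : FreeGroup (Fin 2)}
    (h : Φ (side r ε) = .unit g) : Φ (side r (!ε)) = .unit g := by
  refine PairMonoid.toLayered_eq_unit abHom ?_
  rw [← PairMonoid.toLayered_unit, ← h]
  cases ε
  · exact hl.side_eq r
  · exact (hl.side_eq r).symm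

theorem signedLabel_unit (hl : IsLiftLabelling Φ l) {r : R} {ε : Bool} {g : FreeGroup (Fin 2)}
    (h : Φ (side r ε) = .unit g) : signedLabel l r ε = 1 := by
  cases ε with
  | true => exact hl.unit r g h
  | false => exact inv_eq_one.2 (hl.unit r g (hl.side_not_eq_unit h))

theorem signedLabel_pair (hl : IsLiftLabelling Φ l) {r : R} {ε : Bool}
    {x y x' y' : FreeGroup (Fin 2)} (h : Φ (side r ε) = .pair x y)
    (h' : Φ (side r (!ε)) = .pair x' y') : IsLift (signedLabel l r ε) (x⁻¹ * x') (y⁻¹ * y') := by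
  cases ε with
  | true => exact hl.pair r _ _ _ _ h h'
  | false =>
    have := (hl.pair r _ _ _ _ h' h).inv
    simp only [mul_inv_rev, inv_inv] at this
    exact this

theorem toLayered_edge (hl : IsLiftLabelling Φ l) {x y : DerivationGraph R} (e : x ⟶ y) :
    PairMonoid.toLayered abHom (Φ x) = PairMonoid.toLayered abHom (Φ y) := by
  obtain ⟨w, r, ε, w', rfl, rfl⟩ := e
  have h : PairMonoid.toLayered abHom (Φ (side r ε)) =
      PairMonoid.toLayered abHom (Φ (side r (!ε))) := by
    cases ε
    · exact (hl.side_eq r).symm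
    · exact hl.side_eq r
  have hm : ∀ u v : DerivationGraph R, Φ (u * v) = Φ u * Φ v := map_mul Φ
  simp only [hm, map_mul, h]

theorem toLayered_path (hl : IsLiftLabelling Φ l) {x y : DerivationGraph R}
    (p : Quiver.Path x y) :
    PairMonoid.toLayered abHom (Φ x) = PairMonoid.toLayered abHom (Φ y) := by
  induction p with
  | nil => rfl
  | cons p e ih => exact ih.trans (hl.toLayered_edge e)

theorem edgeLabel_unit (hl : IsLiftLabelling Φ l) {x y : DerivationGraph R} (e : x ⟶ y)
    {g : FreeGroup (Fin 2)} (h : Φ x = .unit g) : edgeLabel l e = 1 := by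
  obtain ⟨w, r, ε, w', rfl, rfl⟩ := e
  have hm : ∀ u v : DerivationGraph R, Φ (u * v) = Φ u * Φ v := map_mul Φ
  rw [hm, hm] at h
  cases h₁ : Φ (side r ε) with
  | unit g => exact hl.signedLabel_unit h₁
  | pair x y =>
    rw [h₁] at h
    cases h₂ : Φ w <;> cases h₃ : Φ w' <;> simp [h₂, h₃] at h
  | zero => rw [h₁] at h; simp at h

/-- Unit contexts cancel in `x⁻¹ * x'` and `y⁻¹ * y'`. If instead the rule is between units, the
lifted pair does not move and the label is 1. -/
theorem edgeLabel_pair (hl : IsLiftLabelling Φ l) {v v' : DerivationGraph R} (e : v ⟶ v')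
    {x y x' y' : FreeGroup (Fin 2)} (h : Φ v = .pair x y) (h' : Φ v' = .pair x' y') :
    IsLift (edgeLabel l e) (x⁻¹ * x') (y⁻¹ * y') := by
  obtain ⟨w, r, ε, w', rfl, rfl⟩ := e
  have hm : ∀ u v : DerivationGraph R, Φ (u * v) = Φ u * Φ v := map_mul Φ
  rw [hm, hm] at h h'
  change IsLift (signedLabel l r ε) _ _
  cases h₁ : Φ (side r ε) with
  | unit g =>
    rw [hl.side_not_eq_unit h₁, ← h₁, h] at h'
    cases h'
    rw [hl.signedLabel_unit h₁, inv_mul_cancel, inv_mul_cancel]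
    exact .one
  | pair s t =>
    cases h₂ : Φ (side r (!ε)) with
    | unit g =>
      have := hl.side_not_eq_unit h₂
      rw [Bool.not_not, h₁] at this
      cases this
    | pair s' t' =>
      have hlift := hl.signedLabel_pair h₁ h₂
      rw [h₁] at h
      rw [h₂] at h'
      cases h₃ : Φ w <;> cases h₄ : Φ w' <;> simp [h₃, h₄] at h h'
      obtain ⟨rfl, rfl⟩ := h
      obtain ⟨rfl, rfl⟩ := h'
      simpa [mul_assoc] using hlift
    | zero => rw [h₂] at h'; simp at h'
  | zero => rw [h₁] at h; simp at h

theorem pathLabel_unit (hl : IsLiftLabelling Φ l) {x y : DerivationGraph R}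
    (p : Quiver.Path x y) {g : FreeGroup (Fin 2)} (h : Φ x = .unit g) : pathLabel l p = 1 := by
  induction p with
  | nil => rfl
  | cons p e ih =>
    have h' := (hl.toLayered_path p).symm
    rw [h] at h'
    rw [pathLabel, ih, one_mul, hl.edgeLabel_unit e (PairMonoid.toLayered_eq_unit abHom h')]

theorem pathLabel_pair (hl : IsLiftLabelling Φ l) {v v' : DerivationGraph R}
    (p : Quiver.Path v v') {x y : FreeGroup (Fin 2)} (h : Φ v = .pair x y) :
    ∀ {x' y' : FreeGroup (Fin 2)}, Φ v' = .pair x' y' →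
      IsLift (pathLabel l p) (x⁻¹ * x') (y⁻¹ * y') := by
  induction p with
  | nil =>
    intro x' y' h'
    rw [h] at h'
    cases h'
    rw [inv_mul_cancel, inv_mul_cancel]
    exact .one
  | cons p e ih =>
    intro x' y' h'
    have h₁ := (hl.toLayered_path p).symm
    rw [h] at h₁
    obtain ⟨s, t, h₂, -⟩ := PairMonoid.toLayered_eq_mid abHom h₁
    have := (ih h₂).mul (hl.edgeLabel_pair e h₂ h')
    rw [pathLabel]
    simpa [mul_assoc] using this

/-- Congruence of labels over nonzero words is a homotopy relation. -/
theorem isHomotopyRelation (hl : IsLiftLabelling Φ l) (D : AddSubgroup ℚ) :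
    IsHomotopyRelation (R := R) fun x _ p q =>
      Φ x ≠ .zero → CongrMod D (pathLabel l p) (pathLabel l q) where
  equivalence _ _ := ⟨fun _ _ => .refl _, fun h hx => (h hx).symm,
    fun h h' hx => (h hx).trans (h' hx)⟩
  interchange {x₁ y₁ x₂ y₂} e₁ e₂ hx := by
    -- Two middle elements multiply to zero, so a nonzero product has a unit factor.
    have he : edgeLabel l e₁ = 1 ∨ edgeLabel l e₂ = 1 := by
      rw [show Φ (x₁ * x₂) = Φ x₁ * Φ x₂ from map_mul Φ _ _] at hx
      cases h₁ : Φ x₁ with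
      | unit g => exact .inl (hl.edgeLabel_unit e₁ h₁)
      | pair x y =>
        cases h₂ : Φ x₂ with
        | unit g => exact .inr (hl.edgeLabel_unit e₂ h₂)
        | pair x' y' => simp [h₁, h₂] at hx
        | zero => simp [h₂] at hx
      | zero => simp [h₁] at hx
    simp only [pathLabel_comp, pathLabel_toPath]
    change CongrMod D (edgeLabel l e₁ * edgeLabel l e₂) (edgeLabel l e₂ * edgeLabel l e₁)
    rcases he with he | he <;> simp only [he, one_mul, mul_one] <;> exact .refl _
  act {x y} p q w z h hx := by
    rw [pathLabel_mapPath_act, pathLabel_mapPath_act]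
    refine h fun h₀ => hx ?_
    change Φ (w * x * z) = _
    rw [show Φ (w * x * z) = Φ w * Φ x * Φ z from (map_mul Φ _ _).trans
      (congrArg (· * _) (map_mul Φ _ _)), h₀]
    simp
  comp {x' x y y'} s p q t h hx := by
    simp only [pathLabel_comp]
    refine ((CongrMod.refl _).mul (h fun h₀ => hx ?_)).mul (.refl _)
    have := hl.toLayered_path s
    rw [h₀] at this
    cases h₁ : Φ x' <;> simp [h₁] at this ⊢
  inv p hx := by
    rw [pathLabel_comp, pathLabel_reverse, mul_inv_cancel]
    exact .refl _

/-- With a finite homotopy base, the labels of parallel paths differ by elements of a finitely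
generated group. -/
theorem exists_finite_congrMod (hl : IsLiftLabelling Φ l) {C : Set (ParallelPair R)}
    (hC : C.Finite) (hbase : IsHomotopyBase C) :
    ∃ s : Set ℚ, s.Finite ∧ ∀ {x y : DerivationGraph R} (p q : Quiver.Path x y), Φ x ≠ .zero →
      CongrMod (AddSubgroup.closure s) (pathLabel l p) (pathLabel l q) := by
  refine ⟨_, hC.image fun c => (pathLabel l c.2.2.1).z - (pathLabel l c.2.2.2).z,
    fun {x y} p q => hbase p q _ (hl.isHomotopyRelation _) fun c hc hx => ?_⟩
  have hz := AddSubgroup.subset_closure (Set.mem_image_of_mem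
    (fun c : ParallelPair R => (pathLabel l c.2.2.1).z - (pathLabel l c.2.2.2).z) hc)
  cases h₁ : Φ c.1 with
  | unit g =>
    rw [hl.pathLabel_unit _ h₁, hl.pathLabel_unit _ h₁]
    exact .refl _
  | pair x y =>
    have h := (hl.toLayered_path c.2.2.1).symm
    rw [h₁] at h
    obtain ⟨x', y', h₂, -⟩ := PairMonoid.toLayered_eq_mid abHom h
    obtain ⟨ht, hx, hy⟩ := (hl.pathLabel_pair c.2.2.1 h₁ h₂).congr
      (hl.pathLabel_pair c.2.2.2 h₁ h₂)
    exact ⟨ht, hx, hy, hz⟩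
  | zero => exact (hx h₁).elim

end IsLiftLabelling

/-- A presentation of the model of `M` has no finite homotopy base. -/
theorem not_presentationFDT_of_model {A : Type u} {R : Set (FreeMonoid A × FreeMonoid A)}
    (e : MonoidOf R ≃* ModelM) : ¬ PresentationFDT R := by
  rintro ⟨C, hC, hbase⟩
  let π : FreeMonoid A →* ModelM :=
    (e : MonoidOf R →* ModelM).comp (PresentedMonoid.mk fun x y => (x, y) ∈ R)
  have hπ : Function.Surjective π := e.surjective.comp PresentedMonoid.surjective_mk
  have hsec := Function.rightInverse_surjInv (PairMonoid.toLayered_surjective abHom abHom_surjective)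
  -- Letters are lifted arbitrarily; freeness of the word monoid makes this a homomorphism over `π`.
  let Φ : FreeMonoid A →* PairMonoid (FreeGroup (Fin 2)) := FreeMonoid.lift fun a =>
    Function.surjInv (PairMonoid.toLayered_surjective abHom abHom_surjective) (π (FreeMonoid.of a))
  have hΦ : ∀ w, PairMonoid.toLayered abHom (Φ w) = π w := by
    have : (PairMonoid.toLayered abHom).comp Φ = π := FreeMonoid.hom_eq fun a => hsec _
    exact DFunLike.congr_fun this
  have hpath : ∀ x y : DerivationGraph R,
      PairMonoid.toLayered abHom (Φ x) = PairMonoid.toLayered abHom (Φ y) →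
        Nonempty (Quiver.Path x y) := by
    intro x y h
    exact reachable_of_mk_eq (e.injective ((hΦ x).symm.trans (h.trans (hΦ y))))
  obtain ⟨l, hl⟩ := exists_isLiftLabelling (R := R) Φ fun r => by
    rw [hΦ, hΦ]
    exact congrArg e (PresentedMonoid.mk_eq_mk_of_rel (rels := fun x y => (x, y) ∈ R) r.2)
  obtain ⟨s, hs, hD⟩ := hl.exists_finite_congrMod hC hbase
  obtain ⟨n, hn⟩ := exists_pow_sub_one_notMem_closure hs
  obtain ⟨w, hw⟩ := hπ (.mid 1)
  obtain ⟨x₀, y₀, hw₀, -⟩ := PairMonoid.toLayered_eq_mid abHom ((hΦ w).trans hw)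
  -- Conjugating by `x₀` and `y₀` makes the displacements exactly `(comm n, 1)` and `(1, comm 1)`;
  -- the inverse in `v` offsets the one in `pair_mul_unit`.
  obtain ⟨u, hu⟩ := hπ (.unit (x₀ * comm n * x₀⁻¹))
  obtain ⟨v, hv⟩ := hπ (.unit (y₀ * (comm 1)⁻¹ * y₀⁻¹))
  have hu₀ := PairMonoid.toLayered_eq_unit abHom ((hΦ u).trans hu)
  have hv₀ := PairMonoid.toLayered_eq_unit abHom ((hΦ v).trans hv)
  have huw : Φ (u * w) = .pair (x₀ * comm n) y₀ := by
    rw [map_mul, hu₀, hw₀, PairMonoid.unit_mul_pair, inv_mul_cancel_right]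
  have hwv : Φ (w * v) = .pair x₀ (y₀ * comm 1) := by
    rw [map_mul, hv₀, hw₀, PairMonoid.pair_mul_unit]
    simp [mul_assoc]
  -- Commutators die in the abelianization, so `w`, `u * w` and `w * v` represent the same element
  -- of the model.
  obtain ⟨p⟩ := hpath w (u * w : FreeMonoid A) (by
    rw [huw, hw₀]
    simp only [PairMonoid.toLayered_pair, map_mul, abHom_comm, mul_one])
  obtain ⟨q⟩ := hpath w (w * v : FreeMonoid A) (by
    rw [hwv, hw₀]
    simp only [PairMonoid.toLayered_pair, map_mul, abHom_comm, mul_one])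
  have hp : IsLift (pathLabel l p) (comm n) 1 := by
    simpa using hl.pathLabel_pair p hw₀ huw
  have hq : IsLift (pathLabel l q) 1 (comm 1) := by
    simpa using hl.pathLabel_pair q hw₀ hwv
  obtain ⟨p', q', hp', hq'⟩ := exists_pathLabel_square l p q
  obtain ⟨-, -, -, hz⟩ := hD p' q' (by rw [hw₀]; simp)
  refine hn ?_
  rw [hp', hq'] at hz
  rw [← hp.mul_z_sub_mul_z hq]
  exact hz

theorem not_hasFDT_monoidM : ¬ HasFDT MonoidM := by
  rintro ⟨A, R, -, -, ⟨e⟩, h⟩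
  exact not_presentationFDT_of_model (e.trans MonoidM.modelEquiv) h

theorem theorem1 :
    (∃ H₁ H₂ H₃ : Set MonoidM,
      H₁ ≠ H₂ ∧ H₁ ≠ H₃ ∧ H₂ ≠ H₃ ∧
      {H : Set MonoidM | IsHClass H} = {H₁, H₂, H₃} ∧
      (∀ x ∈ H₁, Nonempty (SchutzenbergerGroup x ≃* Unit)) ∧
      (∀ x ∈ H₂, Nonempty
        (SchutzenbergerGroup x ≃* Multiplicative (FreeAbelianGroup (Fin 2)))) ∧
      (∀ x ∈ H₃, Nonempty (SchutzenbergerGroup x ≃* FreeGroup (Fin 2)))) ∧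
    (∀ x : MonoidM, HasFiniteCompleteRewriting (SchutzenbergerGroup x) ∧
      HasFDT (SchutzenbergerGroup x)) ∧
    ¬ HasFDT MonoidM ∧
    ¬ HasFiniteCompleteRewriting MonoidM := by
  refine ⟨MonoidM.exists_hClasses, fun x => ?_, not_hasFDT_monoidM, fun h =>
    not_hasFDT_monoidM (hasFDT_of_hasFiniteCompleteRewriting h)⟩
  have h := hasFiniteCompleteRewriting_schutzenbergerGroup x
  exact ⟨h, hasFDT_of_hasFiniteCompleteRewriting h⟩
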